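/- Let $G$ be a locally compact second countable Hausdorff group. All Hilbert spaces are complex and separable and carry a unitary representation $U$ of $G$ for which the action $g.A := U(g)AU(g)^*$ on $B(\mathcal H)$ is ultraweakly continuous. A *semi-quantum system* is an ultraweakly closed $G$-stable subspace $V\subseteq B(\mathcal H)$ with $\mathbb 1\in V$; a *channel* is an ultraweakly continuous (normal), positive, unital linear map $V\to V'$. The predual of $V$ is $\mathcal T(\mathcal H)/\!\sim_V$, where $T\sim_V T'$ iff $\mathrm{tr}[TA]=\mathrm{tr}[T'A]$ for all $A\in V$; a channel $\phi:V\to V'$ has the predual map $\phi_*$ given by $\mathrm{tr}[\phi_*(t)A]=\mathrm{tr}[t\,\phi(A)]$. A *principal semi-quantum frame* $\mathcal R$ is a semi-quantum system $V_{\mathcal R}\subseteq B(\mathcal H_{\mathcal R})$ with a positive operator-valued measure $\mathsf E_{\mathcal R}$ on the Borel sets of $G$ with values in $V_{\mathcal R}$ and $\mathsf E_{\mathcal R}(gX)=g.\mathsf E_{\mathcal R}(X)$; a *frame morphism* $\psi:\mathcal R\to\mathcal R'$ is a channel $\psi:V_{\mathcal R}\to V_{\mathcal R'}$ with $\mathsf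 E_{\mathcal R'}=\psi\circ\mathsf E_{\mathcal R}$. For a semi-quantum system $V_{\mathcal S}\subseteq B(\mathcal H_{\mathcal S})$ let $Y^{\mathcal R}(A)=\int_G d\mathsf E_{\mathcal R}(g)\otimes g.A\in B(\mathcal H_{\mathcal R}\otimes\mathcal H_{\mathcal S})$ (weak integral), let $V_{\mathcal S}^{\mathcal R}$ be the ultraweak closure of $Y^{\mathcal R}(V_{\mathcal S})$, and for states $\omega$ of $\mathcal H_{\mathcal R}$ (or trace-class $\omega$) and $\rho$ of $\mathcal H_{\mathcal S}$ let $\rho^{(\omega)}$ be the class of $\omega\otimes\rho$ in $\mathcal T(\mathcal H_{\mathcal R}\otimes\mathcal H_{\mathcal S})/\!\sim_{V_{\mathcal S}^{\mathcal R}}$ (equivalently, the functional $A\mapsto\mathrm{tr}[(\omega\otimes\rho)Y^{\mathcal R}(A)]$ on $V_{\mathcal S}$). Let $\psi:\mathcal R\to\mathcal R'$ be a frame morphism and fix a semi-quantum system $V_{\mathcal S}$. 1. The linear map $Y(\psi,\mathrm{id}_{\mathcal S}):Y^{\mathcal R}(A)\mapsto Y^{\mathcal R'}(A)$, $A\in V_{\mathcal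 S}$, is well defined on the ultraweakly dense subspace $Y^{\mathcal R}(V_{\mathcal S})$ of $V_{\mathcal S}^{\mathcal R}$. Let $\Phi^{\rm ext}_\psi=Y(\psi,\mathrm{id}_{\mathcal S})_*$ be its predual: its domain consists of those $t'\in\mathcal T(\mathcal H_{\mathcal R'}\otimes\mathcal H_{\mathcal S})/\!\sim_{V_{\mathcal S}^{\mathcal R'}}$ for which there is a (necessarily unique) $t\in\mathcal T(\mathcal H_{\mathcal R}\otimes\mathcal H_{\mathcal S})/\!\sim_{V_{\mathcal S}^{\mathcal R}}$ with $\mathrm{tr}[t\,B]=\mathrm{tr}[t'\,Y(\psi,\mathrm{id}_{\mathcal S})(B)]$ for all $B\in Y^{\mathcal R}(V_{\mathcal S})$, and then $\Phi^{\rm ext}_\psi(t')=t$. 2. For all states $\omega'$ of $\mathcal H_{\mathcal R'}$ and $\rho$ of $\mathcal H_{\mathcal S}$, the product-relative state $\rho^{(\omega')}$ lies in the domain of $\Phi^{\rm ext}_\psi$, and $$\Phi^{\rm ext}_\psi\big(\rho^{(\omega')}\big)=\rho^{(\psi_*(\omega'))},$$ where on the right any trace-class representative $\omega$ of $\psi_*(\omega')\in\mathcal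 T(\mathcal H_{\mathcal R})/\!\sim_{V_{\mathcal R}}$ may be used (if $V_{\mathcal R}=B(\mathcal H_{\mathcal R})$, it is a state). If $Y(\psi,\mathrm{id}_{\mathcal S})$ has an extension to an ultraweakly continuous linear map $V_{\mathcal S}^{\mathcal R}\to V_{\mathcal S}^{\mathcal R'}$, the everywhere defined predual of the extension also maps $\rho^{(\omega')}$ to $\rho^{(\psi_*(\omega'))}$. Moreover $\mathrm{tr}[(\omega'\otimes\rho)\,Y^{\mathcal R'}(A)]=\mathrm{tr}[(\omega\otimes\rho)\,Y^{\mathcal R}(A)]$ for all $A\in V_{\mathcal S}$. 3. For $h\in G$ let $h.\mathcal R$ be the reoriented frame, with $V_{h.\mathcal R}=V_{\mathcal R}$, observable $X\mapsto h.\mathsf E_{\mathcal R}(X)$ and representation $g\mapsto U(h)U(g)U(h)^*$. The frame reorientation $h.\_:V_{\mathcal R}\to V_{\mathcal R}$ is a frame morphism $\mathcal R\to h.\mathcal R$, and for all states $\omega$ of $\mathcal H_{\mathcal R}$ and $\rho$ of $\mathcal H_{\mathcal S}$ the map $\Phi^{\rm ext}_{h.\_}$ sends $\rho^{(\omega)}$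 (relative to $h.\mathcal R$) to $\rho^{(U(h)^*\omega U(h))}$ (relative to $\mathcal R$), where $U(h)^*\omega U(h)$ is a state. If $h.\_$ is also a frame morphism $\mathcal R\to\mathcal R$, then likewise $\Phi^{\rm ext}_{h.\_}$ sends $\rho^{(\omega)}$ to $\rho^{(U(h)^*\omega U(h))}$, both relative to $\mathcal R$. -/

import Mathlib

open scoped InnerProductSpace Topology
open InnerProductSpace MeasureTheory

namespace QRF

section TraceClass

variable {H : Type*} [NormedAddCommGroup H] [InnerProductSpace ℂ H] [CompleteSpace H]

/-- Trace-class operators on a Hilbert space (equivalently: nuclear operators, those with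
`∑ ⟪eᵢ, |T| eᵢ⟫ < ∞`): norm-convergent sums `∑ₙ |xₙ⟩⟨yₙ|` with `∑ₙ ‖xₙ‖ ‖yₙ‖ < ∞`. -/
def IsTraceClass (T : H →L[ℂ] H) : Prop :=
  ∃ x y : ℕ → H, Summable (fun n => ‖x n‖ * ‖y n‖) ∧
    HasSum (fun n => rankOne ℂ (x n) (y n)) T

variable (H) in
/-- The index set of a chosen orthonormal (Hilbert) basis. -/
def basisIndex : Set H := Classical.choose (exists_hilbertBasis ℂ H)

variable (H) in
/-- A chosen orthonormal (Hilbert) basis; the trace does not depend on it. -/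
noncomputable def basis : HilbertBasis (basisIndex H) ℂ H :=
  Classical.choose (Classical.choose_spec (exists_hilbertBasis ℂ H))

/-- The trace `∑ᵢ ⟪eᵢ, T eᵢ⟫`. -/
noncomputable def opTrace (T : H →L[ℂ] H) : ℂ :=
  ∑' i, ⟪basis H i, T (basis H i)⟫_ℂ

theorem hasSum_opTrace {T : H →L[ℂ] H} {x y : ℕ → H}
    (hs : Summable (fun n => ‖x n‖ * ‖y n‖)) (hT : HasSum (fun n => rankOne ℂ (x n) (y n)) T) :
    HasSum (fun i => ⟪basis H i, T (basis H i)⟫_ℂ) (opTrace T) ∧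
      HasSum (fun n => ⟪y n, x n⟫_ℂ) (opTrace T) := by
  set b := basis H with hb
  let F : ℕ × basisIndex H → ℂ := fun p => ⟪y p.1, b p.2⟫_ℂ * ⟪b p.2, x p.1⟫_ℂ
  have h1 : ∀ n, HasSum (fun i => F (n, i)) ⟪y n, x n⟫_ℂ := fun n =>
    b.hasSum_inner_mul_inner (y n) (x n)
  have h2 : ∀ n, Summable (fun i => ‖F (n, i)‖) := fun n => (h1 n).summable.norm
  have sq : ∀ z : H, HasSum (fun i => ‖⟪b i, z⟫_ℂ‖ ^ 2) (‖z‖ ^ 2) := by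
    intro z
    have := b.hasSum_inner_mul_inner z z
    have h := Complex.hasSum_re this
    convert h using 1
    · funext i
      rw [← inner_conj_symm z (b i), ← Complex.normSq_eq_conj_mul_self, Complex.ofReal_re,
        Complex.normSq_eq_norm_sq]
    · rw [inner_self_eq_norm_sq_to_K]; norm_cast
  have h3 : ∀ n, ∑' i, ‖F (n, i)‖ ≤ ‖x n‖ * ‖y n‖ := by
    intro n
    have hh := Real.inner_le_Lp_mul_Lq_tsum_of_nonneg (p := 2) (q := 2)
      (f := fun i => ‖⟪b i, y n⟫_ℂ‖)
      (g := fun i => ‖⟪b i, x n⟫_ℂ‖)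
      (by constructor <;> norm_num) (fun _ => norm_nonneg _) (fun _ => norm_nonneg _)
      (by simpa using (sq (y n)).summable) (by simpa using (sq (x n)).summable)
    have hx := (sq (x n)).tsum_eq
    have hy := (sq (y n)).tsum_eq
    have e : ∀ i, ‖F (n, i)‖ = ‖⟪b i, y n⟫_ℂ‖ * ‖⟪b i, x n⟫_ℂ‖ := by
      intro i; simp only [F, norm_mul]; rw [norm_inner_symm]
    simp only [e]
    refine hh.trans (le_of_eq ?_)
    simp only [Real.rpow_ofNat, hx, hy]
    rw [← Real.sqrt_eq_rpow, ← Real.sqrt_eq_rpow, Real.sqrt_sq (norm_nonneg _),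
      Real.sqrt_sq (norm_nonneg _), mul_comm]
  have hF : Summable F := by
    refine Summable.of_norm ?_
    refine (summable_prod_of_nonneg (fun _ => norm_nonneg _)).2 ⟨h2, ?_⟩
    exact Summable.of_nonneg_of_le (fun n => tsum_nonneg fun _ => norm_nonneg _) h3 hs
  have hA : HasSum (fun n => ⟪y n, x n⟫_ℂ) (∑' p, F p) := hF.hasSum.prod_fiberwise h1
  have h4 : ∀ i, HasSum (fun n => F (n, i)) ⟪b i, T (b i)⟫_ℂ := by
    intro i
    have := hT.mapL ((innerSL ℂ (b i)).comp (ContinuousLinearMap.apply ℂ H (b i)))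
    simpa [F, inner_smul_right] using this
  have hB : HasSum (fun i => ⟪b i, T (b i)⟫_ℂ) (∑' p, F p) := by
    have := ((Equiv.prodComm _ _).hasSum_iff.2 hF.hasSum : HasSum (F ∘ (Equiv.prodComm (basisIndex H) ℕ)) _)
    exact this.prod_fiberwise h4
  have e : opTrace T = ∑' p, F p := hB.tsum_eq
  rw [e]
  exact ⟨hB, hA⟩

theorem IsTraceClass.zero : IsTraceClass (0 : H →L[ℂ] H) :=
  ⟨0, 0, by simp, by simp⟩

theorem IsTraceClass.add {S T : H →L[ℂ] H} (hS : IsTraceClass S) (hT : IsTraceClass T) :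
    IsTraceClass (S + T) := by
  obtain ⟨x, y, h, h'⟩ := hS
  obtain ⟨u, v, k, k'⟩ := hT
  have e := Equiv.natSumNatEquivNat
  refine ⟨fun n => Sum.elim x u (e.symm n), fun n => Sum.elim y v (e.symm n), ?_, ?_⟩
  · refine (e.symm.summable_iff (f := fun s => ‖Sum.elim x u s‖ * ‖Sum.elim y v s‖)).2 ?_
    exact Summable.sum _ (by simpa [Function.comp_def] using h) (by simpa [Function.comp_def] using k)
  · refine (e.symm.hasSum_iff (f := fun s => rankOne ℂ (Sum.elim x u s) (Sum.elim y v s))).2 ?_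
    exact HasSum.sum (by simpa [Function.comp_def] using h') (by simpa [Function.comp_def] using k')

theorem IsTraceClass.comp_left {T : H →L[ℂ] H} (hT : IsTraceClass T) (A : H →L[ℂ] H) :
    IsTraceClass (A * T) := by
  obtain ⟨x, y, h, h'⟩ := hT
  refine ⟨fun n => A (x n), y, ?_, ?_⟩
  · refine Summable.of_nonneg_of_le (fun n => by positivity) (fun n => ?_) (h.mul_left ‖A‖)
    rw [← mul_assoc]; gcongr; exact A.le_opNorm _
  · have := h'.mul_left A
    simpa [ContinuousLinearMap.mul_def, comp_rankOne] using this

theorem IsTraceClass.comp_right {T : H →L[ℂ] H} (hT : IsTraceClass T) (A : H →L[ℂ] H) :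
    IsTraceClass (T * A) := by
  obtain ⟨x, y, h, h'⟩ := hT
  refine ⟨x, fun n => A.adjoint (y n), ?_, ?_⟩
  · refine Summable.of_nonneg_of_le (fun n => by positivity) (fun n => ?_) (h.mul_left ‖A.adjoint‖)
    rw [mul_left_comm]; gcongr; exact A.adjoint.le_opNorm _
  · have := h'.mul_right A
    simpa [ContinuousLinearMap.mul_def, rankOne_comp] using this

theorem IsTraceClass.smul {T : H →L[ℂ] H} (hT : IsTraceClass T) (c : ℂ) : IsTraceClass (c • T) := by
  have := hT.comp_left (c • 1)
  simpa using this

theorem IsTraceClass.hasSum_opTrace {T : H →L[ℂ] H} (hT : IsTraceClass T) :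
    HasSum (fun i => ⟪basis H i, T (basis H i)⟫_ℂ) (opTrace T) := by
  obtain ⟨x, y, h, h'⟩ := hT
  exact (QRF.hasSum_opTrace h h').1

theorem opTrace_mul_comm {T : H →L[ℂ] H} (hT : IsTraceClass T) (A : H →L[ℂ] H) :
    opTrace (A * T) = opTrace (T * A) := by
  obtain ⟨x, y, h, h'⟩ := hT
  have h1 : HasSum (fun n => ⟪y n, A (x n)⟫_ℂ) (opTrace (A * T)) := by
    refine (QRF.hasSum_opTrace ?_ ?_).2
    · refine Summable.of_nonneg_of_le (fun n => by positivity) (fun n => ?_) (h.mul_left ‖A‖)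
      rw [← mul_assoc]; gcongr; exact A.le_opNorm _
    · have := h'.mul_left A
      simpa [ContinuousLinearMap.mul_def, comp_rankOne] using this
  have h2 : HasSum (fun n => ⟪A.adjoint (y n), x n⟫_ℂ) (opTrace (T * A)) := by
    refine (QRF.hasSum_opTrace ?_ ?_).2
    · refine Summable.of_nonneg_of_le (fun n => by positivity) (fun n => ?_) (h.mul_left ‖A.adjoint‖)
      rw [mul_left_comm]; gcongr; exact A.adjoint.le_opNorm _
    · have := h'.mul_right A
      simpa [ContinuousLinearMap.mul_def, rankOne_comp] using this
  simp only [ContinuousLinearMap.adjoint_inner_left] at h2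
  exact h1.unique h2

variable (H) in
/-- The space `𝒯(H)` of trace-class operators. -/
def TraceClass : Submodule ℂ (H →L[ℂ] H) where
  carrier := {T | IsTraceClass T}
  zero_mem' := IsTraceClass.zero
  add_mem' := IsTraceClass.add
  smul_mem' c _ h := IsTraceClass.smul h c

variable (H) in
/-- The duality pairing `(T, A) ↦ tr[T A]` between trace-class and bounded operators. -/
noncomputable def tracePairing : TraceClass H →ₗ[ℂ] (H →L[ℂ] H) →ₗ[ℂ] ℂ :=
  LinearMap.mk₂ ℂ (fun T A => opTrace (T.1 * A))
    (fun S T A => by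
      have hS := (IsTraceClass.comp_right S.2 A).hasSum_opTrace
      have hT := (IsTraceClass.comp_right T.2 A).hasSum_opTrace
      have := (hS.add hT).tsum_eq
      rw [← this]
      simp [opTrace])
    (fun c T A => by
      simp [opTrace, tsum_mul_left])
    (fun T A B => by
      have hS := (IsTraceClass.comp_right T.2 A).hasSum_opTrace
      have hT := (IsTraceClass.comp_right T.2 B).hasSum_opTrace
      have := (hS.add hT).tsum_eq
      rw [← this]
      simp [opTrace])
    (fun c T A => by
      simp [opTrace, tsum_mul_left])

/-- (Quantum) states: positive trace-class operators of trace one. -/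
def IsState (ω : TraceClass H) : Prop :=
  (ω : H →L[ℂ] H).IsPositive ∧ opTrace (ω : H →L[ℂ] H) = 1

variable (H) in
/-- The ultraweak topology on `B(H)`: the coarsest one making all `A ↦ tr[T A]`, with `T`
trace class, continuous. -/
@[reducible]
noncomputable def ultraweak : TopologicalSpace (H →L[ℂ] H) :=
  ⨅ T : TraceClass H, TopologicalSpace.induced (tracePairing H T) inferInstance

end TraceClass

section Predual

variable {H : Type*} [NormedAddCommGroup H] [InnerProductSpace ℂ H] [CompleteSpace H]
variable {H' : Type*} [NormedAddCommGroup H'] [InnerProductSpace ℂ H'] [CompleteSpace H']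

/-- The ultraweak closure of a linear subspace of `B(H)`. -/
noncomputable def ultraweakClosure (V : Submodule ℂ (H →L[ℂ] H)) : Submodule ℂ (H →L[ℂ] H) :=
  letI : TopologicalSpace (H →L[ℂ] H) := ultraweak H
  haveI : IsTopologicalAddGroup (H →L[ℂ] H) :=
    topologicalAddGroup_iInf fun _ => topologicalAddGroup_induced _
  haveI : ContinuousSMul ℂ (H →L[ℂ] H) :=
    continuousSMul_iInf fun _ => continuousSMul_induced _
  V.topologicalClosure

theorem coe_ultraweakClosure (V : Submodule ℂ (H →L[ℂ] H)) :
    (ultraweakClosure V : Set (H →L[ℂ] H)) = @closure _ (ultraweak H) V := rfl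

theorem le_ultraweakClosure (V : Submodule ℂ (H →L[ℂ] H)) : V ≤ ultraweakClosure V :=
  @subset_closure _ (ultraweak H) V

/-- The ultraweak topology restricted to a subspace. -/
@[reducible]
noncomputable def ultraweakOn (V : Submodule ℂ (H →L[ℂ] H)) : TopologicalSpace V :=
  (ultraweak H).induced Subtype.val

/-- A linear map between spaces of operators is normal if it is ultraweakly continuous. -/
def IsNormalMap {V : Submodule ℂ (H →L[ℂ] H)} {V' : Submodule ℂ (H' →L[ℂ] H')}
    (φ : V →ₗ[ℂ] V') : Prop :=
  Continuous[ultraweakOn V, ultraweakOn V'] φ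

/-- `T ↦ (A ↦ tr[T A])`, with `A` restricted to `V`. -/
noncomputable def restrictedPairing (V : Submodule ℂ (H →L[ℂ] H)) :
    TraceClass H →ₗ[ℂ] Module.Dual ℂ V :=
  (LinearMap.lcomp ℂ ℂ V.subtype).comp (tracePairing H)

/-- The predual `𝒯(H)/∼_V`, where `T ∼_V T'` iff `tr[T A] = tr[T' A]` for all `A ∈ V`. -/
abbrev Predual (V : Submodule ℂ (H →L[ℂ] H)) : Type _ :=
  TraceClass H ⧸ LinearMap.ker (restrictedPairing V)

/-- The class in `𝒯(H)/∼_V` of a trace-class operator. -/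
noncomputable def Predual.mk (V : Submodule ℂ (H →L[ℂ] H)) : TraceClass H →ₗ[ℂ] Predual V :=
  (LinearMap.ker (restrictedPairing V)).mkQ

/-- The duality pairing between `𝒯(H)/∼_V` and `V`, `⟨[T], A⟩ = tr[T A]`. -/
noncomputable def Predual.pairing (V : Submodule ℂ (H →L[ℂ] H)) :
    Predual V →ₗ[ℂ] Module.Dual ℂ V :=
  Submodule.liftQ _ (restrictedPairing V) le_rfl

@[simp]
theorem Predual.pairing_mk (V : Submodule ℂ (H →L[ℂ] H)) (T : TraceClass H) (A : V) :
    Predual.pairing V (Predual.mk V T) A = tracePairing H T A := rfl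

theorem Predual.pairing_injective (V : Submodule ℂ (H →L[ℂ] H)) :
    Function.Injective (Predual.pairing V) := by
  rw [← LinearMap.ker_eq_bot]
  exact Submodule.ker_liftQ_eq_bot _ _ _ le_rfl

theorem exists_predual {V : Submodule ℂ (H →L[ℂ] H)} {V' : Submodule ℂ (H' →L[ℂ] H')}
    (φ : V →ₗ[ℂ] V') (hφ : IsNormalMap φ) (t : Predual V') :
    Predual.pairing V' t ∘ₗ φ ∈ LinearMap.range (Predual.pairing V) := by
  obtain ⟨T, rfl⟩ := Submodule.mkQ_surjective _ t
  have h : (restrictedPairing V' T ∘ₗ φ) ∈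
      Submodule.span ℂ (Set.range fun T : TraceClass H => restrictedPairing V T) := by
    rw [LinearMap.mem_span_iff_continuous]
    have e : ultraweakOn V =
        ⨅ T : TraceClass H, TopologicalSpace.induced (restrictedPairing V T) inferInstance := by
      simp only [ultraweakOn, ultraweak, induced_iInf, induced_compose]; rfl
    rw [← e]
    have c1 : Continuous[ultraweak H', inferInstance] (tracePairing H' T) :=
      continuous_iInf_dom continuous_induced_dom
    exact @Continuous.comp _ _ _ (ultraweakOn V) (ultraweak H') _ _ _ c1
      (@Continuous.comp _ _ _ (ultraweakOn V) (ultraweakOn V') (ultraweak H') _ _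
        continuous_induced_dom hφ)
  have h2 : (Set.range fun T : TraceClass H => restrictedPairing V T) =
      (LinearMap.range (restrictedPairing V) : Set (Module.Dual ℂ V)) := rfl
  rw [h2, Submodule.span_eq] at h
  obtain ⟨S, hS⟩ := h
  exact ⟨Predual.mk V S, hS⟩

/-- The predual map `φ_* : 𝒯(H')/∼_V' → 𝒯(H)/∼_V` of a normal map `φ : V → V'`, determined by
`⟨φ_* t, A⟩ = ⟨t, φ A⟩` for `A ∈ V`. -/
noncomputable def predualMap {V : Submodule ℂ (H →L[ℂ] H)} {V' : Submodule ℂ (H' →L[ℂ] H')}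
    (φ : V →ₗ[ℂ] V') (hφ : IsNormalMap φ) : Predual V' →ₗ[ℂ] Predual V :=
  (LinearEquiv.ofInjective _ (Predual.pairing_injective V)).symm.toLinearMap ∘ₗ
    LinearMap.codRestrict _ ((LinearMap.lcomp ℂ ℂ φ).comp (Predual.pairing V'))
      (exists_predual φ hφ)

theorem pairing_predualMap {V : Submodule ℂ (H →L[ℂ] H)} {V' : Submodule ℂ (H' →L[ℂ] H')}
    (φ : V →ₗ[ℂ] V') (hφ : IsNormalMap φ) (t : Predual V') (A : V) :
    Predual.pairing V (predualMap φ hφ t) A = Predual.pairing V' t (φ A) := by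
  have := LinearEquiv.ofInjective_symm_apply (f := Predual.pairing V)
    (h := Predual.pairing_injective V) (LinearMap.codRestrict _ ((LinearMap.lcomp ℂ ℂ φ).comp (Predual.pairing V'))
      (exists_predual φ hφ) t)
  exact congrArg (fun f => f A) this

/-- The predual of a linear map `f : V ⇀ V'` defined on a linear subspace of `V`: its graph consists
of the pairs `(t', t)` with `⟨t, A⟩ = ⟨t', f A⟩` for all `A` in the domain of `f`, so that its
domain is the set of those `t'` for which such a `t` exists. (As for adjoints of unbounded operators,
`t` is unique when the domain of `f` is ultraweakly dense in `V`.) -/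
noncomputable def partialPredual {V : Submodule ℂ (H →L[ℂ] H)} {V' : Submodule ℂ (H' →L[ℂ] H')}
    (f : V →ₗ.[ℂ] V') : Predual V' →ₗ.[ℂ] Predual V :=
  Submodule.toLinearPMap
    { carrier := {p | ∀ A : f.domain, Predual.pairing V p.2 A = Predual.pairing V' p.1 (f A)}
      zero_mem' := by simp
      add_mem' := fun {p q} hp hq A => by simp [hp A, hq A]
      smul_mem' := fun c p hp A => by simp [hp A] }

end Predual

section Systems

variable {G : Type*} [Group G] [TopologicalSpace G]

/-- A unitary representation `U` of `G` on `H` for which the action `g.A = U(g) A U(g)^*` on `B(H)`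
is ultraweakly continuous. -/
structure UnitaryRep (G : Type*) [Group G] [TopologicalSpace G]
    (H : Type*) [NormedAddCommGroup H] [InnerProductSpace ℂ H] [CompleteSpace H] where
  /-- the homomorphism into the unitary group -/
  U : G →* unitary (H →L[ℂ] H)
  continuous_act : ∀ A : H →L[ℂ] H, Continuous[inferInstance, ultraweak H]
    fun g : G => (U g : H →L[ℂ] H) * A * star (U g : H →L[ℂ] H)

/-- The action `g.A = U(g) A U(g)^*`. -/
noncomputable def UnitaryRep.act {H : Type*} [NormedAddCommGroup H] [InnerProductSpace ℂ H]
    [CompleteSpace H] (u : UnitaryRep G H) (g : G) (A : H →L[ℂ] H) : H →L[ℂ] H :=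
  (u.U g : H →L[ℂ] H) * A * star (u.U g : H →L[ℂ] H)

/-- A semi-quantum system: an ultraweakly closed subspace `V ⊆ B(H)` containing the identity and
stable under the action of `G` coming from a unitary representation on `H`. -/
structure SemiQuantumSystem (G : Type*) [Group G] [TopologicalSpace G]
    (H : Type*) [NormedAddCommGroup H] [InnerProductSpace ℂ H] [CompleteSpace H] where
  /-- the unitary representation -/
  rep : UnitaryRep G H
  /-- the space of operators -/
  V : Submodule ℂ (H →L[ℂ] H)
  isClosed : IsClosed[ultraweak H] (V : Set (H →L[ℂ] H))
  one_mem : (1 : H →L[ℂ] H) ∈ V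
  act_mem : ∀ g : G, ∀ A ∈ V, rep.act g A ∈ V

/-- A semi-quantum channel: a normal positive unital linear map `V → V'`. -/
structure Channel {H H' : Type*} [NormedAddCommGroup H] [InnerProductSpace ℂ H] [CompleteSpace H]
    [NormedAddCommGroup H'] [InnerProductSpace ℂ H'] [CompleteSpace H']
    (S : SemiQuantumSystem G H) (S' : SemiQuantumSystem G H') where
  /-- the underlying linear map -/
  toLin : S.V →ₗ[ℂ] S'.V
  normal : IsNormalMap toLin
  positive : ∀ A : S.V, (A : H →L[ℂ] H).IsPositive → (toLin A : H' →L[ℂ] H').IsPositive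
  unital : (toLin ⟨1, S.one_mem⟩ : H' →L[ℂ] H') = 1

/-- The identity channel. -/
def Channel.id {H : Type*} [NormedAddCommGroup H] [InnerProductSpace ℂ H] [CompleteSpace H]
    (S : SemiQuantumSystem G H) : Channel S S where
  toLin := LinearMap.id
  normal := @continuous_id _ (ultraweakOn S.V)
  positive _ h := h
  unital := rfl

/-- The predual map of a channel. -/
noncomputable def Channel.predual {H H' : Type*} [NormedAddCommGroup H] [InnerProductSpace ℂ H]
    [CompleteSpace H] [NormedAddCommGroup H'] [InnerProductSpace ℂ H'] [CompleteSpace H']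
    {S : SemiQuantumSystem G H} {S' : SemiQuantumSystem G H'} (φ : Channel S S') :
    Predual S'.V →ₗ[ℂ] Predual S.V :=
  predualMap φ.toLin φ.normal

/-- A principal semi-quantum reference frame: a semi-quantum system together with a positive
operator-valued measure `E` on the Borel sets of `G` which is covariant and has its effects in `V`.
Only the values of `E` on Borel sets matter. -/
structure Frame (G : Type*) [Group G] [TopologicalSpace G] [MeasurableSpace G]
    (H : Type*) [NormedAddCommGroup H] [InnerProductSpace ℂ H] [CompleteSpace H]
    extends SemiQuantumSystem G H where
  /-- the frame observable -/
  E : Set G → (H →L[ℂ] H)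
  E_pos : ∀ X, MeasurableSet X → (E X).IsPositive
  E_univ : E Set.univ = 1
  E_empty : E ∅ = 0
  E_iUnion : ∀ X : ℕ → Set G, (∀ n, MeasurableSet (X n)) → Pairwise (Function.onFun Disjoint X) →
    ∀ T : TraceClass H,
      HasSum (fun n => tracePairing H T (E (X n))) (tracePairing H T (E (⋃ n, X n)))
  E_covariant : ∀ (g : G) (X : Set G), MeasurableSet X → E ((g * ·) '' X) = rep.act g (E X)
  E_mem : ∀ X, MeasurableSet X → E X ∈ V

/-- A morphism of principal semi-quantum frames `R → R'`: a semi-quantum channel `ψ : V_R → V_R'`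
such that `E_R'(X) = ψ(E_R(X))` for all Borel sets `X`. -/
structure FrameMorphism [MeasurableSpace G] {H H' : Type*} [NormedAddCommGroup H]
    [InnerProductSpace ℂ H] [CompleteSpace H] [NormedAddCommGroup H'] [InnerProductSpace ℂ H']
    [CompleteSpace H'] (R : Frame G H) (R' : Frame G H')
    extends Channel R.toSemiQuantumSystem R'.toSemiQuantumSystem where
  map_E : ∀ (X : Set G) (hX : MeasurableSet X),
    R'.E X = (toLin ⟨R.E X, R.E_mem X hX⟩ : H' →L[ℂ] H')

end Systems

section Tensor

open scoped TensorProduct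

variable {H K : Type*} [NormedAddCommGroup H] [InnerProductSpace ℂ H]
  [NormedAddCommGroup K] [InnerProductSpace ℂ K]

/-- The Hilbert space tensor product. -/
abbrev HTensor (H K : Type*) [NormedAddCommGroup H] [InnerProductSpace ℂ H]
    [NormedAddCommGroup K] [InnerProductSpace ℂ K] : Type _ :=
  UniformSpace.Completion (H ⊗[ℂ] K)

/-- The simple tensor `x ⊗ y` in the Hilbert space tensor product. -/
noncomputable def htmul (x : H) (y : K) : HTensor H K :=
  ((x ⊗ₜ[ℂ] y : H ⊗[ℂ] K) : UniformSpace.Completion (H ⊗[ℂ] K))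

/-- The tensor product `A ⊗ B` of bounded operators. -/
noncomputable def tensorOp (A : H →L[ℂ] H) (B : K →L[ℂ] K) : HTensor H K →L[ℂ] HTensor H K :=
  (TensorProduct.mapL A B).completion

@[simp]
theorem tensorOp_htmul (A : H →L[ℂ] H) (B : K →L[ℂ] K) (x : H) (y : K) :
    tensorOp A B (htmul x y) = htmul (A x) (B y) := by
  simp [tensorOp, htmul]

@[simp]
theorem inner_htmul (x x' : H) (y y' : K) :
    ⟪htmul x y, htmul x' y'⟫_ℂ = ⟪x, x'⟫_ℂ * ⟪y, y'⟫_ℂ := by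
  simp [htmul]

theorem norm_htmul (x : H) (y : K) : ‖htmul x y‖ = ‖x‖ * ‖y‖ := by
  simp [htmul]

theorem htmul_add_left (x x' : H) (y : K) : htmul (x + x') y = htmul x y + htmul x' y := by
  simp [htmul, TensorProduct.add_tmul, UniformSpace.Completion.coe_add]

theorem htmul_smul_left (c : ℂ) (x : H) (y : K) : htmul (c • x) y = c • htmul x y := by
  rw [htmul, htmul, ← UniformSpace.Completion.coe_smul, TensorProduct.smul_tmul']

theorem htmul_add_right (x : H) (y y' : K) : htmul x (y + y') = htmul x y + htmul x y' := by
  simp [htmul, TensorProduct.tmul_add, UniformSpace.Completion.coe_add]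

theorem htmul_smul_right (c : ℂ) (x : H) (y : K) : htmul x (c • y) = c • htmul x y := by
  rw [htmul, htmul, ← UniformSpace.Completion.coe_smul, TensorProduct.tmul_smul]

theorem htmul_induction {p : HTensor H K → Prop} (z : HTensor H K) (hc : IsClosed {z | p z})
    (h : ∀ x y, p (htmul x y)) (ha : ∀ z w, p z → p w → p (z + w)) : p z := by
  refine UniformSpace.Completion.induction_on z hc fun t => ?_
  induction t using TensorProduct.induction_on with
  | zero => simpa [htmul] using h 0 0
  | tmul x y => exact h x y
  | add a b hA hB => rw [UniformSpace.Completion.coe_add]; exact ha _ _ hA hB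

theorem op_ext_htmul {E : Type*} [NormedAddCommGroup E] [InnerProductSpace ℂ E]
    {A B : HTensor H K →L[ℂ] E} (h : ∀ x y, A (htmul x y) = B (htmul x y)) : A = B := by
  ext z
  refine htmul_induction z (isClosed_eq A.continuous B.continuous) h fun z w hz hw => ?_
  rw [map_add, map_add, hz, hw]

theorem op_ext_inner {A B : HTensor H K →L[ℂ] HTensor H K}
    (h : ∀ x y x' y', ⟪htmul x' y', A (htmul x y)⟫_ℂ = ⟪htmul x' y', B (htmul x y)⟫_ℂ) :
    A = B := by
  refine op_ext_htmul fun x y => ext_inner_left ℂ fun z => ?_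
  refine htmul_induction (p := fun z => ⟪z, A (htmul x y)⟫_ℂ = ⟪z, B (htmul x y)⟫_ℂ) z
    (isClosed_eq (by fun_prop) (by fun_prop)) (fun x' y' => h x y x' y') ?_
  intro z w hz hw
  rw [inner_add_left, inner_add_left, hz, hw]

theorem op_ext_diag {A B : HTensor H K →L[ℂ] HTensor H K}
    (h : ∀ x y y', ⟪htmul x y', A (htmul x y)⟫_ℂ = ⟪htmul x y', B (htmul x y)⟫_ℂ) : A = B := by
  refine op_ext_inner fun x y x' y' => ?_
  have key : ∀ C : HTensor H K →L[ℂ] HTensor H K, 4 * ⟪htmul x' y', C (htmul x y)⟫_ℂ =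
      ⟪htmul (x' + x) y', C (htmul (x' + x) y)⟫_ℂ - ⟪htmul (x' + (-1 : ℂ) • x) y', C (htmul (x' + (-1 : ℂ) • x) y)⟫_ℂ
      - Complex.I * ⟪htmul (x' + Complex.I • x) y', C (htmul (x' + Complex.I • x) y)⟫_ℂ
      + Complex.I * ⟪htmul (x' + (-Complex.I) • x) y', C (htmul (x' + (-Complex.I) • x) y)⟫_ℂ := by
    intro C
    simp only [htmul_add_left, htmul_smul_left, map_add, map_smul, inner_add_left, inner_add_right,
      inner_smul_left, inner_smul_right, map_neg, Complex.conj_I, map_one]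
    ring_nf
    simp only [Complex.I_sq]
    ring
  have e : (4 : ℂ) ≠ 0 := by norm_num
  apply mul_left_cancel₀ e
  rw [key A, key B]
  simp only [h]

theorem tensorOp_mul (A A' : H →L[ℂ] H) (B B' : K →L[ℂ] K) :
    tensorOp (A * A') (B * B') = tensorOp A B * tensorOp A' B' := by
  refine op_ext_htmul fun x y => ?_
  simp

theorem norm_tensorOp_le (A : H →L[ℂ] H) (B : K →L[ℂ] K) : ‖tensorOp A B‖ ≤ ‖A‖ * ‖B‖ := by
  refine ContinuousLinearMap.opNorm_le_bound _ (by positivity) fun z => ?_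
  refine UniformSpace.Completion.induction_on z (isClosed_le (by fun_prop) (by fun_prop))
    fun t => ?_
  have : tensorOp A B (t : UniformSpace.Completion (H ⊗[ℂ] K)) = (TensorProduct.mapL A B t : _) := by
    simp [tensorOp]
  rw [this, UniformSpace.Completion.norm_coe, UniformSpace.Completion.norm_coe]
  refine ((TensorProduct.mapL A B).le_opNorm t).trans ?_
  gcongr
  exact TensorProduct.norm_mapL_le A B

theorem tensorOp_rankOne (x y : H) (u v : K) :
    tensorOp (rankOne ℂ x y) (rankOne ℂ u v) = rankOne ℂ (htmul x u) (htmul y v) := by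
  refine op_ext_htmul fun z w => ?_
  rw [tensorOp_htmul, rankOne_apply, rankOne_apply, rankOne_apply, htmul_smul_left,
    htmul_smul_right, smul_smul, inner_htmul]

theorem tensorOp_add_left (A A' : H →L[ℂ] H) (B : K →L[ℂ] K) :
    tensorOp (A + A') B = tensorOp A B + tensorOp A' B := by
  refine op_ext_htmul fun x y => ?_
  rw [_root_.add_apply, tensorOp_htmul, tensorOp_htmul, tensorOp_htmul,
    _root_.add_apply, htmul_add_left]

theorem tensorOp_add_right (A : H →L[ℂ] H) (B B' : K →L[ℂ] K) :
    tensorOp A (B + B') = tensorOp A B + tensorOp A B' := by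
  refine op_ext_htmul fun x y => ?_
  rw [_root_.add_apply, tensorOp_htmul, tensorOp_htmul, tensorOp_htmul,
    _root_.add_apply, htmul_add_right]

theorem tensorOp_smul_left (c : ℂ) (A : H →L[ℂ] H) (B : K →L[ℂ] K) :
    tensorOp (c • A) B = c • tensorOp A B := by
  refine op_ext_htmul fun x y => ?_
  rw [_root_.smul_apply, tensorOp_htmul, tensorOp_htmul,
    _root_.smul_apply, htmul_smul_left]

theorem tensorOp_smul_right (c : ℂ) (A : H →L[ℂ] H) (B : K →L[ℂ] K) :
    tensorOp A (c • B) = c • tensorOp A B := by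
  refine op_ext_htmul fun x y => ?_
  rw [_root_.smul_apply, tensorOp_htmul, tensorOp_htmul,
    _root_.smul_apply, htmul_smul_right]

theorem continuous_tensorOp_left (B : K →L[ℂ] K) :
    Continuous fun A : H →L[ℂ] H => tensorOp A B := by
  have : LipschitzWith ‖B‖₊ fun A : H →L[ℂ] H => tensorOp A B := by
    refine LipschitzWith.of_dist_le_mul fun A A' => ?_
    have e : tensorOp A B - tensorOp A' B = tensorOp (A - A') B := by
      rw [sub_eq_iff_eq_add, ← tensorOp_add_left, sub_add_cancel]
    rw [dist_eq_norm, dist_eq_norm, e, mul_comm]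
    exact norm_tensorOp_le _ _
  exact this.continuous

theorem continuous_tensorOp_right (A : H →L[ℂ] H) :
    Continuous fun B : K →L[ℂ] K => tensorOp A B := by
  have : LipschitzWith ‖A‖₊ fun B : K →L[ℂ] K => tensorOp A B := by
    refine LipschitzWith.of_dist_le_mul fun B B' => ?_
    have e : tensorOp A B - tensorOp A B' = tensorOp A (B - B') := by
      rw [sub_eq_iff_eq_add, ← tensorOp_add_right, sub_add_cancel]
    rw [dist_eq_norm, dist_eq_norm, e]
    exact norm_tensorOp_le _ _
  exact this.continuous

theorem hasSum_tensorOp_left {ι : Type*} {f : ι → H →L[ℂ] H} {A : H →L[ℂ] H} (h : HasSum f A)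
    (B : K →L[ℂ] K) : HasSum (fun i => tensorOp (f i) B) (tensorOp A B) := by
  let φ : (H →L[ℂ] H) →+ (HTensor H K →L[ℂ] HTensor H K) :=
    AddMonoidHom.mk' (fun A => tensorOp A B) fun A A' => tensorOp_add_left A A' B
  have hφ : Continuous φ := continuous_tensorOp_left B
  exact h.map φ hφ

theorem hasSum_tensorOp_right {ι : Type*} {f : ι → K →L[ℂ] K} {B : K →L[ℂ] K} (h : HasSum f B)
    (A : H →L[ℂ] H) : HasSum (fun i => tensorOp A (f i)) (tensorOp A B) := by
  let φ : (K →L[ℂ] K) →+ (HTensor H K →L[ℂ] HTensor H K) :=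
    AddMonoidHom.mk' (fun B => tensorOp A B) fun B B' => tensorOp_add_right A B B'
  have hφ : Continuous φ := continuous_tensorOp_right A
  exact h.map φ hφ

theorem IsTraceClass.tensor {S : H →L[ℂ] H} {T : K →L[ℂ] K} (hS : IsTraceClass S)
    (hT : IsTraceClass T) : IsTraceClass (tensorOp S T) := by
  obtain ⟨x, y, h, h'⟩ := hS
  obtain ⟨u, v, k, k'⟩ := hT
  have hs : Summable fun p : ℕ × ℕ => ‖htmul (x p.1) (u p.2)‖ * ‖htmul (y p.1) (v p.2)‖ := by
    have := h.mul_of_nonneg k (fun _ => by positivity) (fun _ => by positivity)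
    refine this.congr fun p => ?_
    simp only [norm_htmul]; ring
  have hsum : Summable fun p : ℕ × ℕ =>
      rankOne ℂ (htmul (x p.1) (u p.2)) (htmul (y p.1) (v p.2)) :=
    Summable.of_norm (by simpa using hs)
  have hlim : HasSum (fun p : ℕ × ℕ =>
      rankOne ℂ (htmul (x p.1) (u p.2)) (htmul (y p.1) (v p.2))) (tensorOp S T) := by
    have h1 : ∀ n, HasSum (fun m => rankOne ℂ (htmul (x n) (u m)) (htmul (y n) (v m)))
        (tensorOp (rankOne ℂ (x n) (y n)) T) := by
      intro n
      have := hasSum_tensorOp_right k' (rankOne ℂ (x n) (y n))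
      simpa only [tensorOp_rankOne] using this
    have h2 : HasSum (fun n => tensorOp (rankOne ℂ (x n) (y n)) T) (tensorOp S T) :=
      hasSum_tensorOp_left h' T
    have h3 := hsum.hasSum.prod_fiberwise h1
    rw [h2.unique h3]
    exact hsum.hasSum
  refine ⟨fun n => htmul (x (Nat.pairEquiv.symm n).1) (u (Nat.pairEquiv.symm n).2),
    fun n => htmul (y (Nat.pairEquiv.symm n).1) (v (Nat.pairEquiv.symm n).2), ?_, ?_⟩
  · exact (Nat.pairEquiv.symm.summable_iff
      (f := fun p : ℕ × ℕ => ‖htmul (x p.1) (u p.2)‖ * ‖htmul (y p.1) (v p.2)‖)).2 hs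
  · exact (Nat.pairEquiv.symm.hasSum_iff (f := fun p : ℕ × ℕ =>
      rankOne ℂ (htmul (x p.1) (u p.2)) (htmul (y p.1) (v p.2)))).2 hlim

variable [CompleteSpace H] [CompleteSpace K]

/-- The tensor product `S ⊗ T` of trace-class operators. -/
noncomputable def TraceClass.tensor (S : TraceClass H) (T : TraceClass K) :
    TraceClass (HTensor H K) :=
  ⟨tensorOp S T, IsTraceClass.tensor S.2 T.2⟩

end Tensor

section Relativization

variable {H K : Type*} [NormedAddCommGroup H] [InnerProductSpace ℂ H] [CompleteSpace H]
  [NormedAddCommGroup K] [InnerProductSpace ℂ K] [CompleteSpace K]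

theorem isTraceClass_rankOne (x y : H) : IsTraceClass (rankOne ℂ x y) := by
  refine ⟨Pi.single 0 x, Pi.single 0 y, ?_, ?_⟩
  · refine summable_of_ne_finset_zero (s := {0}) fun n hn => ?_
    simp [Pi.single_eq_of_ne (by simpa using hn : n ≠ 0)]
  · have := hasSum_single (f := fun n : ℕ => rankOne ℂ ((Pi.single 0 x : ℕ → H) n)
      ((Pi.single 0 y : ℕ → H) n)) 0 fun n hn => by simp [Pi.single_eq_of_ne hn]
    simpa using this

theorem opTrace_rankOne (x y : H) : opTrace (rankOne ℂ x y) = ⟪y, x⟫_ℂ := by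
  have h := (basis H).hasSum_inner_mul_inner y x
  rw [opTrace, ← h.tsum_eq]
  simp

theorem tracePairing_rankOne (x y : H) (A : H →L[ℂ] H) :
    tracePairing H ⟨rankOne ℂ x y, isTraceClass_rankOne x y⟩ A = ⟪y, A x⟫_ℂ := by
  change opTrace (rankOne ℂ x y * A) = _
  rw [← opTrace_mul_comm (isTraceClass_rankOne x y), ContinuousLinearMap.mul_def, comp_rankOne,
    opTrace_rankOne]

theorem inner_tensorOp_left (A : H →L[ℂ] H) (B : K →L[ℂ] K) (z w : HTensor H K) :
    ⟪tensorOp A B z, w⟫_ℂ = ⟪z, tensorOp A.adjoint B.adjoint w⟫_ℂ := by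
  refine htmul_induction (p := fun z => ⟪tensorOp A B z, w⟫_ℂ = ⟪z, tensorOp A.adjoint B.adjoint w⟫_ℂ)
    z (isClosed_eq (by fun_prop) (by fun_prop)) (fun x y => ?_) ?_
  · refine htmul_induction
      (p := fun w => ⟪tensorOp A B (htmul x y), w⟫_ℂ =
        ⟪htmul x y, tensorOp A.adjoint B.adjoint w⟫_ℂ)
      w (isClosed_eq (by fun_prop) (by fun_prop)) (fun x' y' => ?_) ?_
    · simp [ContinuousLinearMap.adjoint_inner_right]
    · intro u v hu hv
      rw [map_add, inner_add_right, inner_add_right, hu, hv]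
  · intro u v hu hv
    rw [map_add, inner_add_left, inner_add_left, hu, hv]

theorem norm_sum_tensorOp_le {ι : Type*} (s : Finset ι) (E : ι → H →L[ℂ] H) (A : ι → K →L[ℂ] K)
    (hE : ∀ i ∈ s, (E i).IsPositive) (h1 : ∑ i ∈ s, E i = 1) (c : ℝ) (hc : 0 ≤ c)
    (hA : ∀ i ∈ s, ‖A i‖ ≤ c) : ‖∑ i ∈ s, tensorOp (E i) (A i)‖ ≤ c := by
  let r : ι → H →L[ℂ] H := fun i => CFC.sqrt (E i)
  have hr : ∀ i ∈ s, r i * r i = E i := fun i hi =>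
    CFC.sqrt_mul_sqrt_self (E i) ((ContinuousLinearMap.nonneg_iff_isPositive _).2 (hE i hi))
  have hra : ∀ i, (r i).adjoint = r i := fun i =>
    (ContinuousLinearMap.isSelfAdjoint_iff'.1 (IsSelfAdjoint.of_nonneg (CFC.sqrt_nonneg (E i))))
  have hR : ∀ i z w, ⟪tensorOp (r i) (1 : K →L[ℂ] K) z, w⟫_ℂ = ⟪z, tensorOp (r i) 1 w⟫_ℂ := by
    intro i z w
    rw [inner_tensorOp_left, hra]
    congr 3
    exact ContinuousLinearMap.isSelfAdjoint_iff'.1 (IsSelfAdjoint.one _)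
  have hsq : ∀ z : HTensor H K, ∑ i ∈ s, ‖tensorOp (r i) (1 : K →L[ℂ] K) z‖ ^ 2 = ‖z‖ ^ 2 := by
    intro z
    have h2 : ∑ i ∈ s, tensorOp (E i) (1 : K →L[ℂ] K) = 1 := by
      refine op_ext_htmul fun x y => ?_
      have : ∑ i ∈ s, htmul (E i x) y = htmul (∑ i ∈ s, E i x) y := by
        let f : H →+ HTensor H K := AddMonoidHom.mk' (fun x => htmul x y) fun a b =>
          htmul_add_left a b y
        exact (map_sum f _ _).symm
      have e := congrArg (fun T : H →L[ℂ] H => T x) h1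
      simp only [_root_.sum_apply, tensorOp_htmul] at e ⊢
      simp only [_root_.one_apply_eq_self] at e ⊢
      rw [this, e]
    have h3 : ∀ i ∈ s, ((‖tensorOp (r i) (1 : K →L[ℂ] K) z‖ ^ 2 : ℝ) : ℂ) =
        ⟪z, tensorOp (E i) (1 : K →L[ℂ] K) z⟫_ℂ := by
      intro i hi
      have := inner_self_eq_norm_sq_to_K (𝕜 := ℂ) (tensorOp (r i) (1 : K →L[ℂ] K) z)
      rw [hR, ← _root_.mul_apply_eq_comp, ← tensorOp_mul, hr i hi, one_mul] at this
      rw [this]; push_cast; rfl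
    have h4 : ((∑ i ∈ s, ‖tensorOp (r i) (1 : K →L[ℂ] K) z‖ ^ 2 : ℝ) : ℂ) = ((‖z‖ ^ 2 : ℝ) : ℂ) := by
      rw [Complex.ofReal_sum, Finset.sum_congr rfl h3, ← inner_sum]
      have e := congrArg (fun T : HTensor H K →L[ℂ] HTensor H K => T z) h2
      simp only [_root_.sum_apply, _root_.one_apply_eq_self] at e
      rw [e, inner_self_eq_norm_sq_to_K]; push_cast; rfl
    exact_mod_cast h4
  have key : ∀ z w : HTensor H K, ‖⟪z, (∑ i ∈ s, tensorOp (E i) (A i)) w⟫_ℂ‖ ≤ c * ‖z‖ * ‖w‖ := by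
    intro z w
    have h5 : ∀ i ∈ s, ‖⟪z, tensorOp (E i) (A i) w⟫_ℂ‖ ≤
        c * (‖tensorOp (r i) (1 : K →L[ℂ] K) z‖ * ‖tensorOp (r i) (1 : K →L[ℂ] K) w‖) := by
      intro i hi
      have e : tensorOp (E i) (A i) =
          tensorOp (r i) 1 * (tensorOp 1 (A i) * tensorOp (r i) 1) := by
        rw [← tensorOp_mul, ← tensorOp_mul, one_mul, one_mul, mul_one, hr i hi]
      rw [e, _root_.mul_apply_eq_comp, ← hR, _root_.mul_apply_eq_comp]
      refine (norm_inner_le_norm _ _).trans ?_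
      have h6 : ‖tensorOp (1 : H →L[ℂ] H) (A i) (tensorOp (r i) 1 w)‖ ≤
          c * ‖tensorOp (r i) (1 : K →L[ℂ] K) w‖ := by
        refine (ContinuousLinearMap.le_opNorm _ _).trans ?_
        gcongr
        refine (norm_tensorOp_le _ _).trans ?_
        have : ‖(1 : H →L[ℂ] H)‖ ≤ 1 := ContinuousLinearMap.norm_id_le
        calc _ ≤ 1 * c := mul_le_mul this (hA i hi) (norm_nonneg _) zero_le_one
          _ = c := one_mul c
      calc _ ≤ ‖tensorOp (r i) (1 : K →L[ℂ] K) z‖ * (c * ‖tensorOp (r i) (1 : K →L[ℂ] K) w‖) := by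
            gcongr
        _ = _ := by ring
    rw [_root_.sum_apply, inner_sum]
    refine (norm_sum_le _ _).trans ((Finset.sum_le_sum h5).trans ?_)
    rw [← Finset.mul_sum, mul_assoc]
    gcongr
    refine (Real.sum_mul_le_sqrt_mul_sqrt _ _ _).trans (le_of_eq ?_)
    rw [hsq, hsq, Real.sqrt_sq (norm_nonneg _), Real.sqrt_sq (norm_nonneg _)]
  refine ContinuousLinearMap.opNorm_le_bound _ hc fun w => ?_
  set v := (∑ i ∈ s, tensorOp (E i) (A i)) w with hv
  by_cases h0 : ‖v‖ = 0
  · rw [h0]; positivity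
  have := key v w
  rw [← hv, inner_self_eq_norm_sq_to_K] at this
  have h7 : ‖v‖ * ‖v‖ ≤ ‖v‖ * (c * ‖w‖) := by
    calc ‖v‖ * ‖v‖ = ‖((‖v‖ : ℂ)) ^ 2‖ := by rw [norm_pow, Complex.norm_real, norm_norm, sq]
      _ ≤ _ := this
      _ = _ := by ring
  exact le_of_mul_le_mul_left h7 (lt_of_le_of_ne (norm_nonneg _) (Ne.symm h0))

/-- A uniformly bounded sequence of operators has a weak limit along an ultrafilter. -/
theorem exists_ultrafilter_limit {L : Type*} [NormedAddCommGroup L] [InnerProductSpace ℂ L]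
    [CompleteSpace L] (B : ℕ → L →L[ℂ] L) (c : ℝ) (hB : ∀ n, ‖B n‖ ≤ c) :
    ∃ T : L →L[ℂ] L, ∀ z w : L, Filter.Tendsto (fun n => ⟪z, B n w⟫_ℂ)
      (Filter.hyperfilter ℕ : Filter ℕ) (𝓝 ⟪z, T w⟫_ℂ) := by
  have hb : ∀ z w n, ‖⟪z, B n w⟫_ℂ‖ ≤ c * ‖z‖ * ‖w‖ := by
    intro z w n
    refine (norm_inner_le_norm _ _).trans ?_
    calc ‖z‖ * ‖B n w‖ ≤ ‖z‖ * (c * ‖w‖) := by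
          gcongr; exact (B n).le_of_opNorm_le (hB n) w
      _ = _ := by ring
  have ex : ∀ z w, ∃ l : ℂ, ‖l‖ ≤ c * ‖z‖ * ‖w‖ ∧ Filter.Tendsto (fun n => ⟪z, B n w⟫_ℂ)
      (Filter.hyperfilter ℕ : Filter ℕ) (𝓝 l) := by
    intro z w
    obtain ⟨l, hl, h⟩ := (isCompact_closedBall (0 : ℂ) (c * ‖z‖ * ‖w‖)).ultrafilter_le_nhds
      ((Filter.hyperfilter ℕ).map fun n => ⟪z, B n w⟫_ℂ)
      (by
        rw [Filter.le_principal_iff]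
        refine Filter.mem_map.2 (Filter.univ_mem' fun n => ?_)
        simpa using hb z w n)
    exact ⟨l, by simpa using hl, h⟩
  choose F hF hlim using ex
  let form : L →ₗ⋆[ℂ] L →ₗ[ℂ] ℂ := LinearMap.mk₂'ₛₗ (starRingEnd ℂ) (RingHom.id ℂ) F
    (fun z z' w => tendsto_nhds_unique (hlim (z + z') w)
      (by simpa only [inner_add_left] using (hlim z w).add (hlim z' w)))
    (fun a z w => tendsto_nhds_unique (hlim (a • z) w)
      (by simpa only [inner_smul_left, smul_eq_mul] using (hlim z w).const_mul (starRingEnd ℂ a)))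
    (fun z w w' => tendsto_nhds_unique (hlim z (w + w'))
      (by simpa only [map_add, inner_add_right] using (hlim z w).add (hlim z w')))
    (fun a z w => tendsto_nhds_unique (hlim z (a • w))
      (by simpa only [map_smul, inner_smul_right, smul_eq_mul, RingHom.id_apply] using (hlim z w).const_mul a))
  let formL : L →L⋆[ℂ] L →L[ℂ] ℂ := form.mkContinuous₂ c fun z w => hF z w
  refine ⟨(InnerProductSpace.continuousLinearMapOfBilin formL).adjoint, fun z w => ?_⟩
  rw [ContinuousLinearMap.adjoint_inner_right,
    InnerProductSpace.continuousLinearMapOfBilin_apply]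
  exact hlim z w

end Relativization

section Yen

variable {G : Type*} [Group G] [TopologicalSpace G]
variable {H K : Type*} [NormedAddCommGroup H] [InnerProductSpace ℂ H] [CompleteSpace H]
  [NormedAddCommGroup K] [InnerProductSpace ℂ K] [CompleteSpace K]

theorem UnitaryRep.norm_act_le (u : UnitaryRep G K) (g : G) (A : K →L[ℂ] K) :
    ‖u.act g A‖ ≤ ‖A‖ := by
  have h1 : ‖(u.U g : K →L[ℂ] K)‖ ≤ 1 := by
    refine ContinuousLinearMap.opNorm_le_bound _ zero_le_one fun x => ?_
    have h := (Unitary.mem_iff.1 (u.U g).2).1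
    have e := congrArg (fun T : K →L[ℂ] K => ⟪x, T x⟫_ℂ) h
    simp only [_root_.mul_apply_eq_comp, ContinuousLinearMap.star_eq_adjoint,
      ContinuousLinearMap.adjoint_inner_right, _root_.one_apply_eq_self,
      inner_self_eq_norm_sq_to_K] at e
    have e' : ‖(u.U g : K →L[ℂ] K) x‖ ^ 2 = ‖x‖ ^ 2 := by exact_mod_cast e
    rw [one_mul]
    exact le_of_sq_le_sq e'.le (norm_nonneg _)
  have h2 : ‖star (u.U g : K →L[ℂ] K)‖ ≤ 1 := by rwa [norm_star]
  unfold UnitaryRep.act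
  calc _ ≤ ‖(u.U g : K →L[ℂ] K)‖ * ‖A‖ * ‖star (u.U g : K →L[ℂ] K)‖ :=
        (norm_mul_le _ _).trans (by gcongr; exact norm_mul_le _ _)
    _ ≤ 1 * ‖A‖ * 1 := by gcongr
    _ = ‖A‖ := by ring

theorem UnitaryRep.act_add (u : UnitaryRep G K) (g : G) (A B : K →L[ℂ] K) :
    u.act g (A + B) = u.act g A + u.act g B := by
  simp [UnitaryRep.act, mul_add, add_mul]

theorem UnitaryRep.act_smul (u : UnitaryRep G K) (g : G) (c : ℂ) (A : K →L[ℂ] K) :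
    u.act g (c • A) = c • u.act g A := by
  simp [UnitaryRep.act]

theorem UnitaryRep.continuous_inner_act (u : UnitaryRep G K) (A : K →L[ℂ] K) (y y' : K) :
    Continuous fun g : G => ⟪y', u.act g A y⟫_ℂ := by
  have h := u.continuous_act A
  have h2 : Continuous[ultraweak K, inferInstance]
      (tracePairing K ⟨rankOne ℂ y y', isTraceClass_rankOne y y'⟩) :=
    continuous_iInf_dom continuous_induced_dom
  have h3 := @Continuous.comp _ _ _ _ (ultraweak K) _ _ _ h2 h
  refine h3.congr fun g => ?_
  exact tracePairing_rankOne y y' _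

variable [MeasurableSpace G]

theorem Frame.inner_E_nonneg (R : Frame G H) {X : Set G} (hX : MeasurableSet X) (x : H) :
    ((⟪x, R.E X x⟫_ℂ).re : ℂ) = ⟪x, R.E X x⟫_ℂ ∧ 0 ≤ (⟪x, R.E X x⟫_ℂ).re := by
  have h := (R.E_pos X hX).inner_nonneg_right x
  rw [Complex.nonneg_iff] at h
  exact ⟨Complex.ext rfl (by simpa using h.2), h.1⟩

/-- The measure `X ↦ ⟪x, E(X) x⟫ = tr[|x⟩⟨x| E(X)]` on `G` given by the frame observable. -/
noncomputable def Frame.measure (R : Frame G H) (x : H) : Measure G :=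
  Measure.ofMeasurable (fun X _ => ENNReal.ofReal (⟪x, R.E X x⟫_ℂ).re)
    (by simp [R.E_empty])
    (fun X hX hd => by
      have h := R.E_iUnion X hX hd ⟨rankOne ℂ x x, isTraceClass_rankOne x x⟩
      simp only [tracePairing_rankOne] at h
      have h' := Complex.hasSum_re h
      rw [← h'.tsum_eq, ENNReal.ofReal_tsum_of_nonneg
        (fun n => (R.inner_E_nonneg (hX n) x).2) h'.summable])

theorem Frame.measure_apply (R : Frame G H) (x : H) {X : Set G} (hX : MeasurableSet X) :
    R.measure x X = ENNReal.ofReal (⟪x, R.E X x⟫_ℂ).re :=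
  Measure.ofMeasurable_apply X hX

instance Frame.isFiniteMeasure_measure (R : Frame G H) (x : H) : IsFiniteMeasure (R.measure x) :=
  ⟨by rw [R.measure_apply x MeasurableSet.univ]; exact ENNReal.ofReal_lt_top⟩

theorem Frame.measureReal_apply (R : Frame G H) (x : H) {X : Set G} (hX : MeasurableSet X) :
    ((R.measure x).real X : ℂ) = ⟪x, R.E X x⟫_ℂ := by
  rw [Measure.real, R.measure_apply x hX, ENNReal.toReal_ofReal (R.inner_E_nonneg hX x).2,
    (R.inner_E_nonneg hX x).1]

/-- `B = ∫_G dE(g) ⊗ g.A`, in the weak sense: for all `x, y, y'`,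
`⟪x ⊗ y', B (x ⊗ y)⟫ = ∫_G ⟪y', (g.A) y⟫ d⟪x, E(g) x⟫`. By polarization in `x` and density of the
span of simple tensors this determines `B`. -/
def IsRelativization (R : Frame G H) (u : UnitaryRep G K) (A : K →L[ℂ] K)
    (B : HTensor H K →L[ℂ] HTensor H K) : Prop :=
  ∀ (x : H) (y y' : K),
    ⟪htmul x y', B (htmul x y)⟫_ℂ = ∫ g, ⟪y', u.act g A y⟫_ℂ ∂(R.measure x)

theorem IsRelativization.unique {R : Frame G H} {u : UnitaryRep G K} {A : K →L[ℂ] K}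
    {B B' : HTensor H K →L[ℂ] HTensor H K} (h : IsRelativization R u A B)
    (h' : IsRelativization R u A B') : B = B' :=
  op_ext_diag fun x y y' => (h x y y').trans (h' x y y').symm

variable [BorelSpace G]

theorem Frame.integrable_act (R : Frame G H) (u : UnitaryRep G K) (A : K →L[ℂ] K) (x : H)
    (y y' : K) : Integrable (fun g => ⟪y', u.act g A y⟫_ℂ) (R.measure x) := by
  refine Integrable.of_bound
    (u.continuous_inner_act A y y').measurable.aestronglyMeasurable (‖y'‖ * (‖A‖ * ‖y‖)) ?_
  refine Filter.Eventually.of_forall fun g => (norm_inner_le_norm _ _).trans ?_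
  gcongr
  exact ContinuousLinearMap.le_of_opNorm_le _ (u.norm_act_le _ _) _

variable [IsTopologicalGroup G] [SecondCountableTopology G] [T2Space G]

theorem exists_isRelativization (R : Frame G H) (u : UnitaryRep G K) (A : K →L[ℂ] K) :
    ∃ B, IsRelativization R u A B := by
  let s : ℕ → SimpleFunc G G := (stronglyMeasurable_id (α := G)).approx
  have hs : ∀ g, Filter.Tendsto (fun n => s n g) Filter.atTop (𝓝 g) :=
    (stronglyMeasurable_id (α := G)).tendsto_approx
  let X : ℕ → G → Set G := fun n v => s n ⁻¹' {v}
  have hX : ∀ n v, MeasurableSet (X n v) := fun n v => (s n).measurableSet_fiber v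
  let B : ℕ → (HTensor H K →L[ℂ] HTensor H K) := fun n =>
    ∑ v ∈ (s n).range, tensorOp (R.E (X n v)) (u.act v A)
  have hone : ∀ n, ∑ v ∈ (s n).range, R.E (X n v) = 1 := by
    intro n
    rw [← ContinuousLinearMap.coe_inj, ← ext_inner_map]
    intro x
    have h1 : ∑ v ∈ (s n).range, (R.measure x).real (X n v) = (R.measure x).real Set.univ := by
      have := (s n).sum_range_measure_preimage_singleton (R.measure x)
      rw [Measure.real, ← this, ENNReal.toReal_sum fun _ _ => measure_ne_top _ _]
      rfl
    have h2 : ∑ v ∈ (s n).range, ⟪x, R.E (X n v) x⟫_ℂ = ⟪x, x⟫_ℂ := by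
      have h3 := congrArg (fun r : ℝ => (r : ℂ)) h1
      simp only [Complex.ofReal_sum, R.measureReal_apply x (hX n _),
        R.measureReal_apply x MeasurableSet.univ, R.E_univ] at h3
      exact h3
    have h4 := congrArg (starRingEnd ℂ) h2
    rw [← inner_sum, inner_conj_symm, inner_conj_symm] at h4
    simpa using h4
  have hB : ∀ n, ‖B n‖ ≤ ‖A‖ := fun n =>
    norm_sum_tensorOp_le _ _ _ (fun v _ => R.E_pos _ (hX n v)) (hone n) _ (norm_nonneg _)
      fun v _ => u.norm_act_le v A
  obtain ⟨T, hT⟩ := exists_ultrafilter_limit B ‖A‖ hB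
  refine ⟨T, fun x y y' => ?_⟩
  refine tendsto_nhds_unique (hT (htmul x y') (htmul x y)) ?_
  have hc := u.continuous_inner_act A y y'
  have hval : ∀ n, ⟪htmul x y', B n (htmul x y)⟫_ℂ =
      ∫ g, ⟪y', u.act (s n g) A y⟫_ℂ ∂(R.measure x) := by
    intro n
    have e : ∀ g, ⟪y', u.act (s n g) A y⟫_ℂ =
        ∑ v ∈ (s n).range, (X n v).indicator (fun _ => ⟪y', u.act v A y⟫_ℂ) g := by
      intro g
      rw [Finset.sum_eq_single (s n g)]
      · simp [X]
      · intro v _ hv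
        exact Set.indicator_of_notMem (fun h => hv (by simpa [X] using h.symm)) _
      · intro h
        exact absurd ((s n).mem_range_self g) h
    simp only [e]
    rw [integral_finsetSum _ fun v _ => (integrable_const _).indicator (hX n v)]
    simp only [integral_indicator_const _ (hX n _), B, _root_.sum_apply, inner_sum, tensorOp_htmul,
      inner_htmul]
    refine Finset.sum_congr rfl fun v _ => ?_
    rw [← R.measureReal_apply x (hX n v), Complex.real_smul]
  simp only [hval]
  have hlim : Filter.Tendsto (fun n => ∫ g, ⟪y', u.act (s n g) A y⟫_ℂ ∂(R.measure x)) Filter.atTop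
      (𝓝 (∫ g, ⟪y', u.act g A y⟫_ℂ ∂(R.measure x))) := by
    refine tendsto_integral_of_dominated_convergence (fun _ => ‖y'‖ * (‖A‖ * ‖y‖)) (fun n => ?_)
      (integrable_const _) (fun n => ?_) ?_
    · exact (hc.comp_stronglyMeasurable (s n).stronglyMeasurable).aestronglyMeasurable
    · refine Filter.Eventually.of_forall fun g => (norm_inner_le_norm _ _).trans ?_
      gcongr
      exact ContinuousLinearMap.le_of_opNorm_le _ (u.norm_act_le _ _) _
    · exact Filter.Eventually.of_forall fun g => (hc.tendsto g).comp (hs g)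
  exact hlim.mono_left (by rw [← Nat.cofinite_eq_atTop]; exact Filter.hyperfilter_le_cofinite)

/-- The relativization map `A ↦ ∫_G dE(g) ⊗ g.A`. -/
noncomputable def Frame.relativization (R : Frame G H) (u : UnitaryRep G K) :
    (K →L[ℂ] K) →ₗ[ℂ] (HTensor H K →L[ℂ] HTensor H K) where
  toFun A := Classical.choose (exists_isRelativization R u A)
  map_add' A A' := by
    refine IsRelativization.unique (Classical.choose_spec (exists_isRelativization R u (A + A')))
      fun x y y' => ?_
    simp only [u.act_add, _root_.add_apply, inner_add_right]
    rw [integral_add (R.integrable_act u A x y y') (R.integrable_act u A' x y y'),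
      Classical.choose_spec (exists_isRelativization R u A) x y y',
      Classical.choose_spec (exists_isRelativization R u A') x y y']
  map_smul' c A := by
    refine IsRelativization.unique (Classical.choose_spec (exists_isRelativization R u (c • A)))
      fun x y y' => ?_
    simp only [u.act_smul, _root_.smul_apply, inner_smul_right, RingHom.id_apply]
    rw [integral_const_mul, Classical.choose_spec (exists_isRelativization R u A) x y y']

theorem Frame.isRelativization_relativization (R : Frame G H) (u : UnitaryRep G K)
    (A : K →L[ℂ] K) : IsRelativization R u A (R.relativization u A) :=
  Classical.choose_spec (exists_isRelativization R u A)

/-- The space `V_S^R` of relative operators: the ultraweak closure of the image of `V_S` under the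
relativization map. -/
noncomputable def relOps (R : Frame G H) (S : SemiQuantumSystem G K) :
    Submodule ℂ (HTensor H K →L[ℂ] HTensor H K) :=
  ultraweakClosure (S.V.map (R.relativization S.rep))

/-- The relativization map of `R` as a map `V_S → V_S^R`. -/
noncomputable def relMap (R : Frame G H) (S : SemiQuantumSystem G K) : S.V →ₗ[ℂ] relOps R S :=
  ((R.relativization S.rep).domRestrict S.V).codRestrict (relOps R S) fun A =>
    le_ultraweakClosure _ (Submodule.mem_map_of_mem A.2)

/-- The product-relative state `ρ^(ω)`, as a relative state: the class of `ω ⊗ ρ` in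
`𝒯(H_R ⊗ H_S)/∼`, where operators are identified when they have the same expectation values on all
relative operators in `V_S^R`. -/
noncomputable def productRelative (R : Frame G H) (S : SemiQuantumSystem G K) (ω : TraceClass H)
    (ρ : TraceClass K) : Predual (relOps R S) :=
  Predual.mk (relOps R S) (TraceClass.tensor ω ρ)

variable {H' K' : Type*} [NormedAddCommGroup H'] [InnerProductSpace ℂ H'] [CompleteSpace H']
  [NormedAddCommGroup K'] [InnerProductSpace ℂ K'] [CompleteSpace K']

/-- The map `∫ dE_R(g) ⊗ g.A ↦ ∫ d(ψ ∘ E_R)(g) ⊗ g.φ(A)` induced by a frame morphism `ψ : R → R'` and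
a channel `φ : V_S → V_S'` on the ultraweakly dense subspace `{∫ dE_R(g) ⊗ g.A | A ∈ V_S}` of `V_S^R`.
Since `ψ ∘ E_R = E_R'`, its graph consists of the pairs
`(∫ dE_R(g) ⊗ g.A, ∫ dE_R'(g) ⊗ g.φ(A))` with `A ∈ V_S`. -/
noncomputable def yenMap {R : Frame G H} {R' : Frame G H'} (_ψ : FrameMorphism R R')
    {S : SemiQuantumSystem G K} {S' : SemiQuantumSystem G K'} (φ : Channel S S') :
    relOps R S →ₗ.[ℂ] relOps R' S' :=
  (LinearMap.range ((relMap R S).prod (relMap R' S' ∘ₗ φ.toLin))).toLinearPMap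

/-- The external frame transformation along a frame morphism `ψ : R → R'`: the predual of the map
induced by `ψ` and the identity channel of `S`. It leads from relative states with respect to `R'` to
relative states with respect to `R`. -/
noncomputable def externalTransformation {R : Frame G H} {R' : Frame G H'}
    (ψ : FrameMorphism R R') (S : SemiQuantumSystem G K) :
    Predual (relOps R' S) →ₗ.[ℂ] Predual (relOps R S) :=
  partialPredual (yenMap ψ (Channel.id S))

end Yen

section Reorientation

variable {G : Type*} [Group G] [TopologicalSpace G]
variable {H : Type*} [NormedAddCommGroup H] [InnerProductSpace ℂ H] [CompleteSpace H]

theorem UnitaryRep.act_mul (u : UnitaryRep G H) (g h : G) (A : H →L[ℂ] H) :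
    u.act (g * h) A = u.act g (u.act h A) := by
  simp [UnitaryRep.act, mul_assoc]

theorem UnitaryRep.act_one (u : UnitaryRep G H) (A : H →L[ℂ] H) : u.act 1 A = A := by
  simp [UnitaryRep.act]

theorem UnitaryRep.act_id (u : UnitaryRep G H) (g : G) : u.act g 1 = 1 := by
  simp [UnitaryRep.act]

theorem UnitaryRep.act_zero (u : UnitaryRep G H) (g : G) : u.act g 0 = 0 := by
  simp [UnitaryRep.act]

theorem UnitaryRep.act_isPositive (u : UnitaryRep G H) (g : G) {A : H →L[ℂ] H}
    (hA : A.IsPositive) : (u.act g A).IsPositive := by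
  have := hA.conj_adjoint (u.U g : H →L[ℂ] H)
  simpa [UnitaryRep.act, ContinuousLinearMap.mul_def, ContinuousLinearMap.star_eq_adjoint,
    ContinuousLinearMap.comp_assoc] using this

/-- The action on trace-class operators that is predual to `A ↦ h.A = U(h) A U(h)^*`, namely
`ω ↦ U(h)^* ω U(h)`. -/
noncomputable def UnitaryRep.predualAct (u : UnitaryRep G H) (h : G) (ω : TraceClass H) :
    TraceClass H :=
  ⟨star (u.U h : H →L[ℂ] H) * ω.1 * (u.U h : H →L[ℂ] H),
    IsTraceClass.comp_right (IsTraceClass.comp_left ω.2 _) _⟩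

theorem UnitaryRep.tracePairing_predualAct (u : UnitaryRep G H) (h : G) (ω : TraceClass H)
    (A : H →L[ℂ] H) :
    tracePairing H (u.predualAct h ω) A = tracePairing H ω (u.act h A) := by
  change opTrace (star (u.U h : H →L[ℂ] H) * ω.1 * (u.U h : H →L[ℂ] H) * A) =
    opTrace (ω.1 * ((u.U h : H →L[ℂ] H) * A * star (u.U h : H →L[ℂ] H)))
  have e : star (u.U h : H →L[ℂ] H) * ω.1 * (u.U h : H →L[ℂ] H) * A =
      star (u.U h : H →L[ℂ] H) * (ω.1 * ((u.U h : H →L[ℂ] H) * A)) := by simp only [mul_assoc]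
  rw [e, opTrace_mul_comm (IsTraceClass.comp_right ω.2 _)]
  simp only [mul_assoc]

theorem UnitaryRep.continuous_act_right (u : UnitaryRep G H) (h : G) :
    Continuous[ultraweak H, ultraweak H] (u.act h) := by
  refine continuous_iInf_rng.2 fun T => continuous_induced_rng.2 ?_
  have h1 : Continuous[ultraweak H, inferInstance] (tracePairing H (u.predualAct h T)) :=
    continuous_iInf_dom continuous_induced_dom
  convert h1 using 1
  funext A
  exact (u.tracePairing_predualAct h T A).symm

variable [IsTopologicalGroup G]

/-- The representation `g ↦ U(h) U(g) U(h)^* = U(h g h⁻¹)`. -/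
noncomputable def UnitaryRep.conj (u : UnitaryRep G H) (h : G) : UnitaryRep G H where
  U := u.U.comp (MulAut.conj h).toMonoidHom
  continuous_act A := by
    have hc : Continuous fun g : G => h * g * h⁻¹ := by fun_prop
    exact @Continuous.comp _ _ _ _ _ (ultraweak H) _ _ (u.continuous_act A) hc

theorem UnitaryRep.conj_act (u : UnitaryRep G H) (h g : G) (A : H →L[ℂ] H) :
    (u.conj h).act g A = u.act (h * g * h⁻¹) A := rfl

variable [MeasurableSpace G]

/-- The frame `h.R` obtained from `R` by the reorientation `h._ : V_R → V_R`: its observable is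
`X ↦ h.E(X)` on the same space `V_R`, covariant with respect to `g ↦ U(h) U(g) U(h)^*`. -/
noncomputable def Frame.reorient (R : Frame G H) (h : G) : Frame G H where
  rep := R.rep.conj h
  V := R.V
  isClosed := R.isClosed
  one_mem := R.one_mem
  act_mem g A hA := R.act_mem _ A hA
  E X := R.rep.act h (R.E X)
  E_pos X hX := R.rep.act_isPositive h (R.E_pos X hX)
  E_univ := by rw [R.E_univ, R.rep.act_id]
  E_empty := by rw [R.E_empty, R.rep.act_zero]
  E_iUnion X hX hd T := by
    have := R.E_iUnion X hX hd (R.rep.predualAct h T)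
    simpa only [UnitaryRep.tracePairing_predualAct] using this
  E_covariant g X hX := by
    rw [R.E_covariant g X hX, UnitaryRep.conj_act, ← UnitaryRep.act_mul, ← UnitaryRep.act_mul]
    simp
  E_mem X hX := R.act_mem h _ (R.E_mem X hX)

/-- The frame reorientation `h._ : V_R → V_R`, `A ↦ h.A`, as a frame morphism `R → h.R`. -/
noncomputable def Frame.reorientMorphism (R : Frame G H) (h : G) :
    FrameMorphism R (R.reorient h) where
  toLin :=
    { toFun := fun A => ⟨R.rep.act h A, R.act_mem h A A.2⟩
      map_add' := fun A B => Subtype.ext (R.rep.act_add h A B)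
      map_smul' := fun c A => Subtype.ext (R.rep.act_smul h c A) }
  normal := by
    refine continuous_induced_rng.2 ?_
    exact @Continuous.comp _ _ _ (ultraweakOn R.V) (ultraweak H) (ultraweak H) _ _
      (R.rep.continuous_act_right h) continuous_induced_dom
  positive A hA := R.rep.act_isPositive h hA
  unital := R.rep.act_id h
  map_E X hX := rfl

end Reorientation

end QRF

/-! Morally, tr[(ω ⊗ ρ) Y^R(A)] is the integral of g ↦ tr[ρ (g.A)] against the complex measure X ↦
tr[ω E_R(X)], so the frame and ω enter only through that measure
(`tracePairing_relativization_congr`). If ω represents ψ_*(ω'), then tr[ω' E_R'(X)] = tr[ω'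
ψ(E_R(X))] = tr[ω E_R(X)], because the effects lie in V_R. Hence the expectations of Y^R'(A) in ω' ⊗
ρ and of Y^R(A) in ω ⊗ ρ agree (`FrameMorphism.tracePairing_relativization`). No map ψ ⊗ id is
needed.

The rest is duality. For rank-one ω' and ρ the identity shows that Y^R(A) = 0 forces Y^R'(A) = 0, so
Y(ψ, id) is well defined. For states it is exactly the condition that the pair of product-relative
states lie in the graph of the predual, which is single-valued because Y^R(V_S) is ultraweakly dense
in V_S^R. Reorientations are the case where the predual of ψ is ω ↦ U(h)^* ω U(h).

The analytic work is to justify the first sentence, since Y^R(A) is given only by its weak integrals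
against the positive measures ⟪x, E_R(·) x⟫. The complex measure is never constructed. Instead,
simple functions converging to the identity of G give Riemann sums ∑ E_R(s⁻¹{v}) ⊗ v.A. These are
bounded by ‖A‖ and converge weakly on simple tensors; a nuclear decomposition of ω ⊗ ρ into simple
tensors upgrades this to convergence of traces (`Frame.tendsto_tracePairing_relativizationSum`). On
a Riemann sum the trace factorizes into terms tr[ω E_R(s⁻¹{v})] tr[ρ (v.A)], so the sums for the two
frames agree term by term. -/

namespace QRF

/-! ### Polarization in the frame factor -/

section Polarization

variable {H K : Type*} [NormedAddCommGroup H] [InnerProductSpace ℂ H]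
  [NormedAddCommGroup K] [InnerProductSpace ℂ K]

/-- Relativizations are defined by matrix elements that are diagonal in the first factor. Solving
for the off-diagonal ones transfers limits, and not only equalities, from the former to the latter.
-/
theorem inner_htmul_polarization (x x' : H) (y y' : K) (C : HTensor H K →L[ℂ] HTensor H K) :
    ⟪htmul x' y', C (htmul x y)⟫_ℂ =
      4⁻¹ * (⟪htmul (x' + x) y', C (htmul (x' + x) y)⟫_ℂ
      - ⟪htmul (x' + (-1 : ℂ) • x) y', C (htmul (x' + (-1 : ℂ) • x) y)⟫_ℂ
      - Complex.I * ⟪htmul (x' + Complex.I • x) y', C (htmul (x' + Complex.I • x) y)⟫_ℂ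
      + Complex.I * ⟪htmul (x' + (-Complex.I) • x) y', C (htmul (x' + (-Complex.I) • x) y)⟫_ℂ) := by
  simp only [htmul_add_left, htmul_smul_left, map_add, map_smul, inner_add_left, inner_add_right,
    inner_smul_left, inner_smul_right, map_neg, Complex.conj_I, map_one]
  ring_nf
  simp only [Complex.I_sq]
  ring

end Polarization

/-! ### Trace pairings through nuclear decompositions -/

section TraceClass

variable {H : Type*} [NormedAddCommGroup H] [InnerProductSpace ℂ H] [CompleteSpace H]
variable {K : Type*} [NormedAddCommGroup K] [InnerProductSpace ℂ K] [CompleteSpace K]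

/-- T A is again nuclear, with vectors x n and A^*(y n). The trace becomes a series of matrix
elements of A, accessible to weak convergence, and any decomposition of T may be used. -/
theorem hasSum_tracePairing (T : TraceClass H) {x y : ℕ → H}
    (hs : Summable fun n => ‖x n‖ * ‖y n‖)
    (hT : HasSum (fun n => rankOne ℂ (x n) (y n)) (T : H →L[ℂ] H)) (A : H →L[ℂ] H) :
    HasSum (fun n => ⟪y n, A (x n)⟫_ℂ) (tracePairing H T A) := by
  have h : HasSum (fun n => ⟪A.adjoint (y n), x n⟫_ℂ) (opTrace (T.1 * A)) := by
    refine (QRF.hasSum_opTrace ?_ ?_).2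
    · refine Summable.of_nonneg_of_le (fun n => by positivity) (fun n => ?_) (hs.mul_left ‖A.adjoint‖)
      rw [mul_left_comm]; gcongr; exact A.adjoint.le_opNorm _
    · have := hT.mul_right A
      simpa [ContinuousLinearMap.mul_def, rankOne_comp] using this
  simp only [ContinuousLinearMap.adjoint_inner_left] at h
  exact h

theorem continuous_tracePairing (T : TraceClass H) :
    Continuous[ultraweak H, inferInstance] (tracePairing H T) :=
  continuous_iInf_dom continuous_induced_dom

/-- The trace pairing with a fixed trace-class operator is continuous along bounded weakly convergent
sequences; weak convergence is only needed on the vectors of a nuclear decomposition. -/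
theorem tendsto_tracePairing_of_bounded (T : TraceClass H) {x y : ℕ → H}
    (hs : Summable fun n => ‖x n‖ * ‖y n‖)
    (hT : HasSum (fun n => rankOne ℂ (x n) (y n)) (T : H →L[ℂ] H))
    {B : ℕ → H →L[ℂ] H} {B' : H →L[ℂ] H} {c : ℝ} (hB : ∀ k, ‖B k‖ ≤ c)
    (hlim : ∀ n, Filter.Tendsto (fun k => ⟪y n, B k (x n)⟫_ℂ) Filter.atTop (𝓝 ⟪y n, B' (x n)⟫_ℂ)) :
    Filter.Tendsto (fun k => tracePairing H T (B k)) Filter.atTop (𝓝 (tracePairing H T B')) := by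
  -- Dominated convergence for series: the uniform bound on the operators gives the summable
  -- majorant c ‖x n‖ ‖y n‖.
  simp only [← (hasSum_tracePairing T hs hT _).tsum_eq]
  refine tendsto_tsum_of_dominated_convergence (bound := fun n => c * (‖x n‖ * ‖y n‖))
    (hs.mul_left c) hlim (Filter.Eventually.of_forall fun k n => ?_)
  refine (norm_inner_le_norm _ _).trans ?_
  calc ‖y n‖ * ‖B k (x n)‖ ≤ ‖y n‖ * (c * ‖x n‖) := by
        gcongr; exact (B k).le_of_opNorm_le (hB k) _
    _ = c * (‖x n‖ * ‖y n‖) := by ring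

/-- The trace-class property of a tensor product forgets which vectors occur. Here they are kept
explicit: all of them are simple tensors, the only vectors on which weak convergence of Riemann sums
is known. -/
theorem tensor_decomposition (e : ℕ ≃ ℕ × ℕ) {S : TraceClass H} {T : TraceClass K} {x y : ℕ → H} {u v : ℕ → K}
    (h : Summable fun n => ‖x n‖ * ‖y n‖)
    (h' : HasSum (fun n => rankOne ℂ (x n) (y n)) (S : H →L[ℂ] H))
    (k : Summable fun n => ‖u n‖ * ‖v n‖)
    (k' : HasSum (fun n => rankOne ℂ (u n) (v n)) (T : K →L[ℂ] K)) :
    Summable (fun n : ℕ => ‖htmul (x (e n).1) (u (e n).2)‖ *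
        ‖htmul (y (e n).1) (v (e n).2)‖) ∧
      HasSum (fun n : ℕ => rankOne ℂ (htmul (x (e n).1) (u (e n).2))
          (htmul (y (e n).1) (v (e n).2)))
        (TraceClass.tensor S T : HTensor H K →L[ℂ] HTensor H K) := by
  have hs : Summable fun p : ℕ × ℕ => ‖htmul (x p.1) (u p.2)‖ * ‖htmul (y p.1) (v p.2)‖ := by
    refine (h.mul_of_nonneg k (fun _ => by positivity) (fun _ => by positivity)).congr fun p => ?_
    simp only [norm_htmul]; ring
  have hsum : Summable fun p : ℕ × ℕ =>
      rankOne ℂ (htmul (x p.1) (u p.2)) (htmul (y p.1) (v p.2)) :=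
    Summable.of_norm (by simpa using hs)
  have hlim : HasSum (fun p : ℕ × ℕ =>
      rankOne ℂ (htmul (x p.1) (u p.2)) (htmul (y p.1) (v p.2)))
      (tensorOp (S : H →L[ℂ] H) (T : K →L[ℂ] K)) := by
    have h1 : ∀ n, HasSum (fun m => rankOne ℂ (htmul (x n) (u m)) (htmul (y n) (v m)))
        (tensorOp (rankOne ℂ (x n) (y n)) (T : K →L[ℂ] K)) := fun n => by
      simpa only [tensorOp_rankOne] using hasSum_tensorOp_right k' (rankOne ℂ (x n) (y n))
    -- Absolute summability gives some sum of the double family; continuity of the tensor product in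
    -- each factor computes the iterated sum, which must be the same.
    rw [(hasSum_tensorOp_left h' (T : K →L[ℂ] K)).unique (hsum.hasSum.prod_fiberwise h1)]
    exact hsum.hasSum
  exact ⟨(e.summable_iff (f := fun p : ℕ × ℕ =>
      ‖htmul (x p.1) (u p.2)‖ * ‖htmul (y p.1) (v p.2)‖)).2 hs,
    (e.hasSum_iff (f := fun p : ℕ × ℕ =>
      rankOne ℂ (htmul (x p.1) (u p.2)) (htmul (y p.1) (v p.2)))).2 hlim⟩

theorem hasSum_mul_of_complex {ι κ : Type*} {f : ι → ℂ} {g : κ → ℂ} {a b : ℂ} (hf : HasSum f a)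
    (hg : HasSum g b) : HasSum (fun p : ι × κ => f p.1 * g p.2) (a * b) :=
  hf.mul hg (summable_mul_of_summable_norm (f := f) (g := g) hf.summable.norm hg.summable.norm)

/-- Along the simple-tensor decomposition each matrix element is a product, and the double series is
the product of two absolutely convergent ones. -/
theorem tracePairing_tensor_tensorOp (S : TraceClass H) (T : TraceClass K) (A : H →L[ℂ] H)
    (B : K →L[ℂ] K) :
    tracePairing (HTensor H K) (TraceClass.tensor S T) (tensorOp A B) =
      tracePairing H S A * tracePairing K T B := by
  obtain ⟨x, y, h, h'⟩ := S.2
  obtain ⟨u, v, k, k'⟩ := T.2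
  obtain ⟨e⟩ : Nonempty (ℕ ≃ ℕ × ℕ) := ⟨Nat.pairEquiv.symm⟩
  obtain ⟨hs, hd⟩ := tensor_decomposition e h h' k k'
  have hF := hasSum_tracePairing S h h' A
  have hG := hasSum_tracePairing T k k' B
  refine (hasSum_tracePairing _ hs hd _).unique ?_
  have := e.hasSum_iff.2 (hasSum_mul_of_complex hF hG)
  simpa only [tensorOp_htmul, inner_htmul, Function.comp_def] using this

/-- On tensor products of trace-class operators, bounded sequences that converge weakly on simple
tensors converge in the trace pairing. -/
theorem tendsto_tracePairing_tensor (S : TraceClass H) (T : TraceClass K)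
    {B : ℕ → HTensor H K →L[ℂ] HTensor H K} {B' : HTensor H K →L[ℂ] HTensor H K} {c : ℝ}
    (hB : ∀ k, ‖B k‖ ≤ c)
    (hlim : ∀ x y u v, Filter.Tendsto (fun k => ⟪htmul y v, B k (htmul x u)⟫_ℂ) Filter.atTop
      (𝓝 ⟪htmul y v, B' (htmul x u)⟫_ℂ)) :
    Filter.Tendsto (fun k => tracePairing (HTensor H K) (TraceClass.tensor S T) (B k)) Filter.atTop
      (𝓝 (tracePairing (HTensor H K) (TraceClass.tensor S T) B')) := by
  obtain ⟨x, y, h, h'⟩ := S.2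
  obtain ⟨u, v, k, k'⟩ := T.2
  obtain ⟨e⟩ : Nonempty (ℕ ≃ ℕ × ℕ) := ⟨Nat.pairEquiv.symm⟩
  obtain ⟨hs, hd⟩ := tensor_decomposition e h h' k k'
  exact tendsto_tracePairing_of_bounded _ hs hd hB fun n => hlim _ _ _ _

/-- Products of rank-one operators recover every matrix element on simple tensors, so identities of
expectations become identities of operators. -/
theorem tracePairing_tensor_rankOne (x y : H) (u v : K) (B : HTensor H K →L[ℂ] HTensor H K) :
    tracePairing (HTensor H K) (TraceClass.tensor ⟨rankOne ℂ x y, isTraceClass_rankOne x y⟩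
      ⟨rankOne ℂ u v, isTraceClass_rankOne u v⟩) B = ⟪htmul y v, B (htmul x u)⟫_ℂ := by
  rw [← tracePairing_rankOne]
  congr 2
  exact Subtype.ext (tensorOp_rankOne x y u v)

open ComplexOrder in
-- With r the square root of A, cyclicity gives tr[ω A] = tr[r ω r], whose diagonal terms ⟪r eᵢ, ω
-- (r eᵢ)⟫ are nonnegative.
theorem tracePairing_nonneg {ω : TraceClass H} (hω : (ω : H →L[ℂ] H).IsPositive)
    {A : H →L[ℂ] H} (hA : A.IsPositive) : 0 ≤ tracePairing H ω A := by
  set r : H →L[ℂ] H := CFC.sqrt A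
  have hr : r * r = A :=
    CFC.sqrt_mul_sqrt_self A ((ContinuousLinearMap.nonneg_iff_isPositive _).2 hA)
  have hra : r.adjoint = r :=
    ContinuousLinearMap.isSelfAdjoint_iff'.1 (IsSelfAdjoint.of_nonneg (CFC.sqrt_nonneg A))
  change 0 ≤ opTrace (ω.1 * A)
  rw [← hr, ← mul_assoc, ← opTrace_mul_comm (IsTraceClass.comp_right ω.2 r)]
  refine tsum_nonneg fun i => ?_
  rw [_root_.mul_apply_eq_comp, _root_.mul_apply_eq_comp, ← ContinuousLinearMap.adjoint_inner_left,
    hra]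
  exact hω.inner_nonneg_right _

theorem tracePairing_one (ω : TraceClass H) : tracePairing H ω 1 = opTrace (ω : H →L[ℂ] H) := by
  change opTrace (ω.1 * 1) = _
  rw [mul_one]

open ComplexOrder in
-- Expressing states by their expectation values makes the property pass through predual maps.
-- Conversely, positivity of the operator is read off from expectations of the projections |x⟩⟨x|,
-- up to scaling.
theorem isState_iff_tracePairing (ω : TraceClass H) :
    IsState ω ↔ (∀ A : H →L[ℂ] H, A.IsPositive → 0 ≤ tracePairing H ω A) ∧
      tracePairing H ω 1 = 1 := by
  rw [IsState, tracePairing_one]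
  refine and_congr_left fun _ => ⟨fun h A hA => tracePairing_nonneg h hA, fun h => ?_⟩
  have hn : ∀ x, 0 ≤ ⟪x, (ω : H →L[ℂ] H) x⟫_ℂ := by
    intro x
    have := h (rankOne ℂ x x) (isPositive_rankOne_self x)
    change 0 ≤ opTrace (ω.1 * rankOne ℂ x x) at this
    rwa [ContinuousLinearMap.mul_def, comp_rankOne, opTrace_rankOne] at this
  -- The criterion uses ⟪ω x, x⟫, the conjugate of the number just bounded. Nonnegativity in ℂ
  -- includes being real, so both agree.
  rw [ContinuousLinearMap.isPositive_iff_complex]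
  intro x
  have h1 := hn x
  rw [Complex.nonneg_iff] at h1
  rw [← inner_conj_symm, Complex.conj_eq_iff_im.2 h1.2.symm]
  exact ⟨Complex.ext rfl h1.2, h1.1⟩

end TraceClass

/-! ### Preduals and density -/

section Predual

variable {H : Type*} [NormedAddCommGroup H] [InnerProductSpace ℂ H] [CompleteSpace H]
variable {H' : Type*} [NormedAddCommGroup H'] [InnerProductSpace ℂ H'] [CompleteSpace H']

/-- Elements of the predual of an ultraweak closure are determined by their values on the subspace. -/
theorem Predual.ext_of_ultraweakClosure {W : Submodule ℂ (H →L[ℂ] H)}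
    {s t : Predual (ultraweakClosure W)}
    (h : ∀ (A : H →L[ℂ] H) (hA : A ∈ W), Predual.pairing _ s ⟨A, le_ultraweakClosure W hA⟩ =
      Predual.pairing _ t ⟨A, le_ultraweakClosure W hA⟩) : s = t := by
  obtain ⟨S, rfl⟩ := Submodule.mkQ_surjective _ s
  obtain ⟨T, rfl⟩ := Submodule.mkQ_surjective _ t
  refine Predual.pairing_injective _ (LinearMap.ext fun A => ?_)
  -- Two ultraweakly continuous functionals agree on an ultraweakly closed set, which therefore
  -- contains the closure of W.
  have hc : IsClosed[ultraweak H] {A | tracePairing H S A = tracePairing H T A} :=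
    @isClosed_eq _ _ _ (ultraweak H) _ _ _ (continuous_tracePairing S) (continuous_tracePairing T)
  exact @closure_minimal _ (ultraweak H) (W : Set (H →L[ℂ] H)) _ (fun A hA => h A hA) hc A.1 A.2

/-- The graph of the predual of a linear map with determining domain. -/
theorem mem_graph_partialPredual {V : Submodule ℂ (H →L[ℂ] H)} {V' : Submodule ℂ (H' →L[ℂ] H')}
    (f : V →ₗ.[ℂ] V')
    (hf : ∀ t : Predual V, (∀ A : f.domain, Predual.pairing V t A = 0) → t = 0)
    {t' : Predual V'} {t : Predual V}
    (h : ∀ A : f.domain, Predual.pairing V t A = Predual.pairing V' t' (f A)) :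
    (t', t) ∈ (partialPredual f).graph := by
  -- `Submodule.toLinearPMap` has the prescribed graph only when that submodule is single-valued;
  -- otherwise its values default to zero. The second goal is this single-valuedness, which `hf`
  -- supplies.
  rw [partialPredual, Submodule.toLinearPMap_graph_eq]
  · exact h
  · rintro ⟨s', s⟩ hs hs'
    refine hf s fun A => ?_
    have := hs A
    simp only at hs'
    rw [this, hs', map_zero, LinearMap.zero_apply]

end Predual

/-! ### Riemann sums for the relativization -/

section Yen

variable {G : Type*} [Group G] [TopologicalSpace G]
variable {H K : Type*} [NormedAddCommGroup H] [InnerProductSpace ℂ H] [CompleteSpace H]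
  [NormedAddCommGroup K] [InnerProductSpace ℂ K] [CompleteSpace K]
variable {H' : Type*} [NormedAddCommGroup H'] [InnerProductSpace ℂ H'] [CompleteSpace H']
-- Duality phrased for an arbitrary representative ω. Its expectations are controlled on V_R only,
-- which suffices because the effects of the frame lie there.
theorem tracePairing_eq_of_mk_eq_predual {R : SemiQuantumSystem G H} {R' : SemiQuantumSystem G H'}
    {ψ : Channel R R'} {ω : TraceClass H} {ω' : TraceClass H'}
    (h : Predual.mk R.V ω = ψ.predual (Predual.mk R'.V ω')) (A : R.V) :
    tracePairing H' ω' (ψ.toLin A) = tracePairing H ω A := by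
  rw [← Predual.pairing_mk R.V, h]
  exact (pairing_predualMap ψ.toLin ψ.normal (Predual.mk R'.V ω') A).symm

variable [MeasurableSpace G]

/-- The fibres of s partition G. Additivity is applied to the scalar measures ⟪x, E(·) x⟫, and over
ℂ these quadratic forms determine the operator. -/
theorem Frame.sum_E_fibers (R : Frame G H) (s : SimpleFunc G G) :
    ∑ v ∈ s.range, R.E (s ⁻¹' {v}) = 1 := by
  have hX : ∀ v, MeasurableSet (s ⁻¹' {v}) := fun v => s.measurableSet_fiber v
  rw [← ContinuousLinearMap.coe_inj, ← ext_inner_map]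
  intro x
  have h1 : ∑ v ∈ s.range, (R.measure x).real (s ⁻¹' {v}) = (R.measure x).real Set.univ := by
    have := s.sum_range_measure_preimage_singleton (R.measure x)
    rw [Measure.real, ← this, ENNReal.toReal_sum fun _ _ => measure_ne_top _ _]
    rfl
  have h2 : ∑ v ∈ s.range, ⟪x, R.E (s ⁻¹' {v}) x⟫_ℂ = ⟪x, x⟫_ℂ := by
    have h3 := congrArg (fun r : ℝ => (r : ℂ)) h1
    simp only [Complex.ofReal_sum, R.measureReal_apply x (hX _),
      R.measureReal_apply x MeasurableSet.univ, R.E_univ] at h3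
    exact h3
  -- Conjugation matches the convention ⟪T x, x⟫ of `ext_inner_map`.
  have h4 := congrArg (starRingEnd ℂ) h2
  rw [← inner_sum, inner_conj_symm, inner_conj_symm] at h4
  simpa using h4

/-- The Riemann sum `∑ᵥ E(s⁻¹{v}) ⊗ v.A` of the relativization of `A` along a simple function `s`. -/
noncomputable def Frame.relativizationSum (R : Frame G H) (u : UnitaryRep G K) (s : SimpleFunc G G)
    (A : K →L[ℂ] K) : HTensor H K →L[ℂ] HTensor H K :=
  ∑ v ∈ s.range, tensorOp (R.E (s ⁻¹' {v})) (u.act v A)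

/-- Positive effects summing to 1 act like convex weights: splitting each into square roots and
applying Cauchy–Schwarz bounds the sum by the largest ‖v.A‖. The bound does not depend on s, as
dominated convergence requires. -/
theorem Frame.norm_relativizationSum_le (R : Frame G H) (u : UnitaryRep G K) (s : SimpleFunc G G)
    (A : K →L[ℂ] K) : ‖R.relativizationSum u s A‖ ≤ ‖A‖ :=
  norm_sum_tensorOp_le _ _ _ (fun v _ => R.E_pos _ (s.measurableSet_fiber v)) (R.sum_E_fibers s) _
    (norm_nonneg _) fun v _ => u.norm_act_le v A

/-- The integrand is a step function taking finitely many values, so the Riemann sum is its exact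
integral. Convergence of Riemann sums thus reduces to convergence of integrands. -/
theorem Frame.inner_relativizationSum (R : Frame G H) (u : UnitaryRep G K) (s : SimpleFunc G G)
    (A : K →L[ℂ] K) (x : H) (y y' : K) :
    ⟪htmul x y', R.relativizationSum u s A (htmul x y)⟫_ℂ =
      ∫ g, ⟪y', u.act (s g) A y⟫_ℂ ∂(R.measure x) := by
  have e : ∀ g, ⟪y', u.act (s g) A y⟫_ℂ =
      ∑ v ∈ s.range, (s ⁻¹' {v}).indicator (fun _ => ⟪y', u.act v A y⟫_ℂ) g := by
    intro g
    rw [Finset.sum_eq_single (s g)]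
    · simp
    · intro v _ hv
      exact Set.indicator_of_notMem (fun h => hv (by simpa using h.symm)) _
    · intro h
      exact absurd (s.mem_range_self g) h
  simp only [e]
  rw [integral_finsetSum _ fun v _ => (integrable_const _).indicator (s.measurableSet_fiber v)]
  simp only [integral_indicator_const _ (s.measurableSet_fiber _), relativizationSum,
    _root_.sum_apply, inner_sum, tensorOp_htmul, inner_htmul]
  refine Finset.sum_congr rfl fun v _ => ?_
  rw [← R.measureReal_apply x (s.measurableSet_fiber v), Complex.real_smul]

variable [BorelSpace G] [IsTopologicalGroup G] [SecondCountableTopology G] [T2Space G]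

/-- For x = x', the integrands converge pointwise by continuity of the action and are bounded by a
constant, integrable for the finite measure of x. -/
theorem Frame.tendsto_inner_relativizationSum (R : Frame G H) (u : UnitaryRep G K)
    {s : ℕ → SimpleFunc G G} (hs : ∀ g, Filter.Tendsto (fun n => s n g) Filter.atTop (𝓝 g))
    (A : K →L[ℂ] K) (x x' : H) (y y' : K) :
    Filter.Tendsto (fun n => ⟪htmul x' y', R.relativizationSum u (s n) A (htmul x y)⟫_ℂ)
      Filter.atTop (𝓝 ⟪htmul x' y', R.relativization u A (htmul x y)⟫_ℂ) := by
  have hdiag : ∀ x : H,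
      Filter.Tendsto (fun n => ⟪htmul x y', R.relativizationSum u (s n) A (htmul x y)⟫_ℂ)
        Filter.atTop (𝓝 ⟪htmul x y', R.relativization u A (htmul x y)⟫_ℂ) := by
    intro x
    simp only [R.inner_relativizationSum, R.isRelativization_relativization u A x y y']
    have hc := u.continuous_inner_act A y y'
    refine tendsto_integral_of_dominated_convergence (fun _ => ‖y'‖ * (‖A‖ * ‖y‖)) (fun n => ?_)
      (integrable_const _) (fun n => ?_) ?_
    · exact (hc.comp_stronglyMeasurable (s n).stronglyMeasurable).aestronglyMeasurable
    · refine Filter.Eventually.of_forall fun g => (norm_inner_le_norm _ _).trans ?_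
      gcongr
      exact ContinuousLinearMap.le_of_opNorm_le _ (u.norm_act_le _ _) _
    · exact Filter.Eventually.of_forall fun g => (hc.tendsto g).comp (hs g)
  -- Off-diagonal matrix elements are fixed linear combinations of four diagonal ones.
  simp only [inner_htmul_polarization x x']
  exact ((((hdiag _).sub (hdiag _)).sub ((hdiag _).const_mul _)).add
    ((hdiag _).const_mul _)).const_mul _

/-- The uniform norm bound and weak convergence on simple tensors give convergence of traces. In the
factorized sums the frame and ω appear only through the numbers tr[ω E(X)]. -/
theorem Frame.tendsto_tracePairing_relativizationSum (R : Frame G H) (u : UnitaryRep G K)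
    {s : ℕ → SimpleFunc G G} (hs : ∀ g, Filter.Tendsto (fun n => s n g) Filter.atTop (𝓝 g))
    (A : K →L[ℂ] K) (ω : TraceClass H) (ρ : TraceClass K) :
    Filter.Tendsto (fun n => ∑ v ∈ (s n).range,
        tracePairing H ω (R.E (s n ⁻¹' {v})) * tracePairing K ρ (u.act v A)) Filter.atTop
      (𝓝 (tracePairing (HTensor H K) (TraceClass.tensor ω ρ) (R.relativization u A))) := by
  refine (tendsto_tracePairing_tensor ω ρ (fun n => R.norm_relativizationSum_le u (s n) A)
    fun x x' y y' => R.tendsto_inner_relativizationSum u hs A x x' y y').congr fun n => ?_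
  simp only [relativizationSum, map_sum, tracePairing_tensor_tensorOp]

/-- `tr[(ω ⊗ ρ) ∫ dE(g) ⊗ g.A]` depends on the frame and on `ω` only through `X ↦ tr[ω E(X)]`. -/
theorem tracePairing_relativization_congr {R : Frame G H} {R' : Frame G H'} {ω : TraceClass H}
    {ω' : TraceClass H'}
    (h : ∀ X, MeasurableSet X → tracePairing H' ω' (R'.E X) = tracePairing H ω (R.E X))
    (u : UnitaryRep G K) (A : K →L[ℂ] K) (ρ : TraceClass K) :
    tracePairing (HTensor H' K) (TraceClass.tensor ω' ρ) (R'.relativization u A) =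
      tracePairing (HTensor H K) (TraceClass.tensor ω ρ) (R.relativization u A) := by
  -- One approximating sequence on G serves both frames, so the two sequences of Riemann sums
  -- coincide and have the same limit.
  have hs := (stronglyMeasurable_id (α := G)).tendsto_approx
  refine tendsto_nhds_unique (R'.tendsto_tracePairing_relativizationSum u hs A ω' ρ)
    ((R.tendsto_tracePairing_relativizationSum u hs A ω ρ).congr fun n => ?_)
  exact Finset.sum_congr rfl fun v _ => by rw [h _ (SimpleFunc.measurableSet_fiber _ v)]

end Yen

/-! ### External transformations of product-relative states -/

section ExternalTransformation

variable {G : Type*} [Group G] [TopologicalSpace G] [IsTopologicalGroup G]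
  [SecondCountableTopology G] [T2Space G] [MeasurableSpace G] [BorelSpace G]
variable {H H' K : Type*} [NormedAddCommGroup H] [InnerProductSpace ℂ H] [CompleteSpace H]
  [NormedAddCommGroup H'] [InnerProductSpace ℂ H'] [CompleteSpace H']
  [NormedAddCommGroup K] [InnerProductSpace ℂ K] [CompleteSpace K]
variable {R : Frame G H} {R' : Frame G H'}

/-- The two scalar set functions coincide since E_R' = ψ ∘ E_R and ω represents ψ_*(ω'). Neither ω'
nor ρ has to be a state; this freedom is what yields well-definedness below. -/
theorem FrameMorphism.tracePairing_relativization (ψ : FrameMorphism R R') {ω : TraceClass H}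
    {ω' : TraceClass H'} (h : Predual.mk R.V ω = ψ.toChannel.predual (Predual.mk R'.V ω'))
    (u : UnitaryRep G K) (A : K →L[ℂ] K) (ρ : TraceClass K) :
    tracePairing (HTensor H' K) (TraceClass.tensor ω' ρ) (R'.relativization u A) =
      tracePairing (HTensor H K) (TraceClass.tensor ω ρ) (R.relativization u A) := by
  refine tracePairing_relativization_congr (fun X hX => ?_) u A ρ
  rw [ψ.map_E X hX]
  exact tracePairing_eq_of_mk_eq_predual h _

/-- By linearity this is the well-definedness of Y^R(A) ↦ Y^R'(A). Matrix elements of Y^R'(A) are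
trace pairings with rank-one products, and each equals a trace pairing with Y^R(A). -/
theorem FrameMorphism.relativization_eq_zero (ψ : FrameMorphism R R') (u : UnitaryRep G K)
    {A : K →L[ℂ] K} (hA : R.relativization u A = 0) : R'.relativization u A = 0 := by
  refine op_ext_inner fun x y x' y' => ?_
  obtain ⟨ω, hω⟩ := Submodule.mkQ_surjective _
    (ψ.toChannel.predual (Predual.mk R'.V ⟨rankOne ℂ x x', isTraceClass_rankOne x x'⟩))
  rw [← tracePairing_tensor_rankOne, ψ.tracePairing_relativization hω, hA]
  simp

theorem mem_graph_yenMap (ψ : FrameMorphism R R') (S : SemiQuantumSystem G K) {p} :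
    p ∈ (yenMap ψ (Channel.id S)).graph ↔ ∃ A : S.V, (relMap R S A, relMap R' S A) = p := by
  -- As for preduals, the graph is the prescribed one only if it is single-valued; this is the
  -- inclusion of kernels just shown.
  rw [yenMap, Submodule.toLinearPMap_graph_eq]
  · rfl
  · rintro _ ⟨A, rfl⟩ hA
    exact Subtype.ext (ψ.relativization_eq_zero S.rep (congrArg Subtype.val hA))

theorem exists_yenMap_relMap (ψ : FrameMorphism R R') (S : SemiQuantumSystem G K) (A : S.V) :
    ∃ hA : relMap R S A ∈ (yenMap ψ (Channel.id S)).domain,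
      yenMap ψ (Channel.id S) ⟨relMap R S A, hA⟩ = relMap R' S A := by
  have h : (relMap R S A, relMap R' S A) ∈ (yenMap ψ (Channel.id S)).graph :=
    (mem_graph_yenMap ψ S).2 ⟨A, rfl⟩
  have hd := LinearPMap.mem_domain_iff.2 ⟨_, h⟩
  exact ⟨hd, ((LinearPMap.image_iff hd).2 h).symm⟩

theorem Predual.ext_relOps {S : SemiQuantumSystem G K} {s t : Predual (relOps R S)}
    (h : ∀ A : S.V, Predual.pairing _ s (relMap R S A) = Predual.pairing _ t (relMap R S A)) :
    s = t :=
  Predual.ext_of_ultraweakClosure fun _ ⟨A, hA, e⟩ => by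
    subst e
    exact h ⟨A, hA⟩

/-- The external transformation maps the product-relative state of `ω'` to that of any representative
of the class `ψ_* ω'`. -/
theorem externalTransformation_productRelative (ψ : FrameMorphism R R') (S : SemiQuantumSystem G K)
    {ω : TraceClass H} {ω' : TraceClass H'}
    (h : Predual.mk R.V ω = ψ.toChannel.predual (Predual.mk R'.V ω')) (ρ : TraceClass K) :
    ∃ hd : productRelative R' S ω' ρ ∈ (externalTransformation ψ S).domain,
      externalTransformation ψ S ⟨productRelative R' S ω' ρ, hd⟩ = productRelative R S ω ρ := by
  have hg : (productRelative R' S ω' ρ, productRelative R S ω ρ) ∈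
      (externalTransformation ψ S).graph := by
    -- Two conditions remain: the domain of Y(ψ, id) separates the predual, by ultraweak density of
    -- Y^R(V_S), and the pair satisfies the duality identity.
    refine mem_graph_partialPredual _ (fun t ht => Predual.ext_relOps fun A => ?_) fun B => ?_
    · rw [ht ⟨_, (exists_yenMap_relMap ψ S A).1⟩, map_zero, LinearMap.zero_apply]
    -- Every element B of the domain is some Y^R(A) with image Y^R'(A), so the identity of
    -- expectations applies.
    · obtain ⟨A, hA⟩ := (mem_graph_yenMap ψ S).1 ((yenMap ψ (Channel.id S)).mem_graph B)
      obtain ⟨h1, h2⟩ := Prod.mk.inj hA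
      rw [← h1, ← h2]
      exact (ψ.tracePairing_relativization h S.rep A ρ).symm
  have hd := LinearPMap.mem_domain_iff.2 ⟨_, hg⟩
  exact ⟨hd, ((LinearPMap.image_iff hd).2 hg).symm⟩

/-- Only the values of the extension on Y^R(V_S) matter, since they already determine a class in the
predual of the closure. -/
theorem predualMap_productRelative (ψ : FrameMorphism R R') (S : SemiQuantumSystem G K)
    {ω : TraceClass H} {ω' : TraceClass H'}
    (h : Predual.mk R.V ω = ψ.toChannel.predual (Predual.mk R'.V ω')) (ρ : TraceClass K)
    (Y : relOps R S →ₗ[ℂ] relOps R' S) (hY : IsNormalMap Y)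
    (hYA : ∀ A : S.V, Y (relMap R S A) = relMap R' S A) :
    predualMap Y hY (productRelative R' S ω' ρ) = productRelative R S ω ρ := by
  refine Predual.ext_relOps fun A => ?_
  rw [pairing_predualMap, hYA]
  exact ψ.tracePairing_relativization h S.rep A ρ

end ExternalTransformation

/-! ### Preservation of states and reorientations -/

section States

variable {G : Type*} [Group G] [TopologicalSpace G]
variable {H H' : Type*} [NormedAddCommGroup H] [InnerProductSpace ℂ H] [CompleteSpace H]
  [NormedAddCommGroup H'] [InnerProductSpace ℂ H'] [CompleteSpace H']

/-- When V is everything, the class fixes all expectations of ω, and positivity and unitality of the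
channel dualize. For smaller V a representative need not be positive. -/
theorem isState_of_mk_eq_predual {S : SemiQuantumSystem G H} {S' : SemiQuantumSystem G H'}
    {ψ : Channel S S'} {ω : TraceClass H} {ω' : TraceClass H'} (hω' : IsState ω') (hS : S.V = ⊤)
    (h : Predual.mk S.V ω = ψ.predual (Predual.mk S'.V ω')) : IsState ω := by
  rw [isState_iff_tracePairing] at hω' ⊢
  refine ⟨fun A hA => ?_, ?_⟩
  · have hm : A ∈ S.V := hS ▸ Submodule.mem_top
    rw [← tracePairing_eq_of_mk_eq_predual h ⟨A, hm⟩]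
    exact hω'.1 _ (ψ.positive ⟨A, hm⟩ hA)
  · rw [← tracePairing_eq_of_mk_eq_predual h ⟨1, S.one_mem⟩, ψ.unital, hω'.2]

theorem isState_predualAct (u : UnitaryRep G H) (h : G) {ω : TraceClass H} (hω : IsState ω) :
    IsState (u.predualAct h ω) := by
  rw [isState_iff_tracePairing] at hω ⊢
  simp only [u.tracePairing_predualAct, u.act_id]
  exact ⟨fun A hA => hω.1 _ (u.act_isPositive h hA), hω.2⟩

/-- A channel implemented by `A ↦ h.A` has predual `ω ↦ U(h)^* ω U(h)`. -/
theorem mk_predualAct (u : UnitaryRep G H) (h : G) {S S' : SemiQuantumSystem G H} {χ : Channel S S'}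
    (hχ : ∀ A : S.V, (χ.toLin A : H →L[ℂ] H) = u.act h A) (ω : TraceClass H) :
    Predual.mk S.V (u.predualAct h ω) = χ.predual (Predual.mk S'.V ω) := by
  refine Predual.pairing_injective _ (LinearMap.ext fun A => ?_)
  refine Eq.trans ?_ (pairing_predualMap χ.toLin χ.normal (Predual.mk S'.V ω) A).symm
  rw [Predual.pairing_mk, Predual.pairing_mk, hχ, u.tracePairing_predualAct]

end States

end QRF

theorem mainTheorem3 {G : Type*} [Group G] [TopologicalSpace G] [IsTopologicalGroup G]
    [LocallyCompactSpace G] [SecondCountableTopology G] [T2Space G] [MeasurableSpace G]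
    [BorelSpace G] {HR HR' HS : Type*}
    [NormedAddCommGroup HR] [InnerProductSpace ℂ HR] [CompleteSpace HR]
    [TopologicalSpace.SeparableSpace HR]
    [NormedAddCommGroup HR'] [InnerProductSpace ℂ HR'] [CompleteSpace HR']
    [TopologicalSpace.SeparableSpace HR']
    [NormedAddCommGroup HS] [InnerProductSpace ℂ HS] [CompleteSpace HS]
    [TopologicalSpace.SeparableSpace HS]
    (R : QRF.Frame G HR) (R' : QRF.Frame G HR') (ψ : QRF.FrameMorphism R R')
    (S : QRF.SemiQuantumSystem G HS) :
    -- `Y(ψ, id_S)` is well defined and maps `Y^R(A)` to `Y^R'(A)`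
    (∀ A : S.V, ∃ hA : QRF.relMap R S A ∈ (QRF.yenMap ψ (QRF.Channel.id S)).domain,
      QRF.yenMap ψ (QRF.Channel.id S) ⟨QRF.relMap R S A, hA⟩ = QRF.relMap R' S A) ∧
    -- its predual maps `ρ^(ω')` to `ρ^(ω)`, for every representative `ω` of `ψ_*(ω')`
    (∀ (ω' : QRF.TraceClass HR') (ρ : QRF.TraceClass HS), QRF.IsState ω' → QRF.IsState ρ →
      ∀ ω : QRF.TraceClass HR,
        QRF.Predual.mk R.V ω = ψ.toChannel.predual (QRF.Predual.mk R'.V ω') →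
        (R.V = ⊤ → QRF.IsState ω) ∧
        (∃ h : QRF.productRelative R' S ω' ρ ∈ (QRF.externalTransformation ψ S).domain,
          QRF.externalTransformation ψ S ⟨QRF.productRelative R' S ω' ρ, h⟩ =
            QRF.productRelative R S ω ρ) ∧
        -- the same for the everywhere defined predual of any normal extension of `Y(ψ, id_S)`
        (∀ (Y : QRF.relOps R S →ₗ[ℂ] QRF.relOps R' S) (hY : QRF.IsNormalMap Y),
          (∀ A : S.V, Y (QRF.relMap R S A) = QRF.relMap R' S A) →
          QRF.predualMap Y hY (QRF.productRelative R' S ω' ρ) = QRF.productRelative R S ω ρ) ∧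
        -- the two product-relative states agree as states of the system, `Y^R'_*(ω' ⊗ ρ) = Y^R_*(ω ⊗ ρ)`
        (∀ A : S.V,
          QRF.tracePairing (QRF.HTensor HR' HS) (QRF.TraceClass.tensor ω' ρ) (R'.relativization S.rep A) =
            QRF.tracePairing (QRF.HTensor HR HS) (QRF.TraceClass.tensor ω ρ) (R.relativization S.rep A))) ∧
    -- frame reorientations `h._ : R → h.R`, and `h._ : R → R` when this is a frame morphism
    (∀ (h : G) (ω : QRF.TraceClass HR) (ρ : QRF.TraceClass HS), QRF.IsState ω → QRF.IsState ρ →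
      QRF.IsState (R.rep.predualAct h ω) ∧
      (∃ hd : QRF.productRelative (R.reorient h) S ω ρ ∈
          (QRF.externalTransformation (R.reorientMorphism h) S).domain,
        QRF.externalTransformation (R.reorientMorphism h) S
            ⟨QRF.productRelative (R.reorient h) S ω ρ, hd⟩ =
          QRF.productRelative R S (R.rep.predualAct h ω) ρ) ∧
      (∀ χ : QRF.FrameMorphism R R,
        (∀ A : R.V, (χ.toLin A : HR →L[ℂ] HR) = R.rep.act h A) →
        ∃ hd : QRF.productRelative R S ω ρ ∈ (QRF.externalTransformation χ S).domain,
          QRF.externalTransformation χ S ⟨QRF.productRelative R S ω ρ, hd⟩ =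
            QRF.productRelative R S (R.rep.predualAct h ω) ρ)) := by
  refine ⟨QRF.exists_yenMap_relMap ψ S, fun ω' ρ hω' _ ω hω => ⟨?_, ?_, ?_, ?_⟩,
    fun h ω ρ hω _ => ⟨QRF.isState_predualAct R.rep h hω, ?_, fun χ hχ => ?_⟩⟩
  · exact fun hR => QRF.isState_of_mk_eq_predual hω' hR hω
  · exact QRF.externalTransformation_productRelative ψ S hω ρ
  · exact QRF.predualMap_productRelative ψ S hω ρ
  · exact fun A => ψ.tracePairing_relativization hω S.rep A ρ
  -- U(h)^* ω U(h) represents the predual class of ω, so both reorientation claims are instances of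
  -- the general result.
  · exact QRF.externalTransformation_productRelative (R.reorientMorphism h) S
      (QRF.mk_predualAct R.rep h (fun _ => rfl) ω) ρ
  · exact QRF.externalTransformation_productRelative χ S (QRF.mk_predualAct R.rep h hχ ω) ρ
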